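/- **Conventions.** An automaton $A$ is a finite deterministic automaton with finite event set $\Sigma^A$, partial transition function, generated language $L(A)$ and marked language $L_m(A)$ (the empty automaton, with $L(A)=\emptyset$, is allowed). $\overline K$ is the prefix closure of $K$; $A$ is nonblocking if $\overline{L_m(A)}=L(A)$; $A\equiv B$ means $\Sigma^A=\Sigma^B$, $L(A)=L(B)$ and $L_m(A)=L_m(B)$. $A\parallel B$ is the synchronous product (shared events are executed jointly, the others are interleaved). $P_\Sigma$ erases from a string all events outside $\Sigma$, and $P_\Sigma(A)$ is the automaton over $\Sigma^A\cap\Sigma$ with languages $P_\Sigma(L(A))$ and $P_\Sigma(L_m(A))$ obtained by subset construction. For a set $\Sigma_c$ of controllable events, $K\subseteq L(A)$ is controllable w.r.t. $A$ if $s\in\overline K$, $\sigma\in\Sigma^A\setminus\Sigma_c$, $s\sigma\in L(A)$ imply $s\sigma\in\overline K$. $\mathrm{Supcon}(C,A)$ is the nonblocking automaton over $\Sigma^A$ (unique up to $\equiv$) whose marked language is the largest sublanguage of $L_m(A\parallel C)$ that is controllable w.r.t. $A$. A language $K\subseteq L_m(A)$ is observable w.r.t. $A$ and $P_\Sigma$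 if for all $s,s'$ with $P_\Sigma(s)=P_\Sigma(s')$: (1) for $\sigma\in\Sigma^A$, $s\sigma\in\overline K$, $s'\in\overline K$, $s'\sigma\in L(A)$ imply $s'\sigma\in\overline K$; (2) $s\in K$, $s'\in\overline K\cap L_m(A)$ imply $s'\in K$. $P_\Sigma$ is an $L_m(A)$-observer if for all $t\in P_\Sigma(L_m(A))$ and $s\in L(A)$ with $P_\Sigma(s)$ a prefix of $t$ there is $u$ with $su\in L_m(A)$ and $P_\Sigma(su)=t$. $P_\Sigma$ is output control consistent (OCC) for $L(A)$ if, whenever $s'\sigma_1\cdots\sigma_r\in L(A)$, where $s'$ is empty or ends with an event of $\Sigma$, $\sigma_1,\dots,\sigma_{r-1}\notin\Sigma$ and $\sigma_r\in\Sigma\setminus\Sigma_c$, all $\sigma_1,\dots,\sigma_r$ are uncontrollable. **Setting.** A distributed constraint specification network consists of $n\ge 2$ nonblocking agent automata $A_1,\dots,A_n$ with pairwise disjoint event sets, a set $\Sigma_c$ of controllable events (write $\Sigma^{A_i}_c=\Sigma^{A_i}\cap\Sigma_c$), and $m\ge 1$ constraints: for each $k\le m$ a nonempty group $J_k\subseteq\{1,\dots,n\}$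 and an automaton $C^k$ with $\Sigma^{C^k}\subseteq\bigcup_{i\in J_k}\Sigma^{A_i}$ and $\Sigma^{C^k}\cap\Sigma^{A_i}\ne\emptyset$ for all $i\in J_k$. Its basic subnets are the pairs $\mathcal N_1^k=(J_k,C^k)$. Put $A_J=\parallel_{i\in J}A_i$, $\Sigma_J=\bigcup_{i\in J}\Sigma^{A_i}$ and $SUP^k=\mathrm{Supcon}(C^k,A_{J_k})$. *CMreduce.* An automaton $S'$ is a result of $CMreduce(S,A_i)$ if $A_i\parallel S'\equiv A_i\parallel S$. *CMBasicSubnet($\mathcal N^k_1$).* Choose $\Sigma_{com}\subseteq\Sigma_{J_k}$ of minimal cardinality such that $L_m(SUP^k)$ is controllable w.r.t. $A_{J_k}$ and observable w.r.t. $A_{J_k}$ and $P_{\Sigma^{A_i}\cup\Sigma_{com}}$ for all $i\in J_k$. For $i\in J_k$ take $P_{\Sigma^{A_i}\cup\Sigma_{com}}(SUP^k)$, add at each state a self-loop for every event of its event set outside $\Sigma^{A_i}_c$ that is not defined there, and let the local coordination module $S^k_i$ be a result of $CMreduce$ applied to this automaton and $A_i$. *DeconflictBasicSubnet($\mathcal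 N^h_1,\mathcal N^k_1$).* Choose $\Sigma_1$ with $\Sigma_{J_h\cap J_k}\subseteq\Sigma_1\subseteq\Sigma_{J_h\cup J_k}$ such that $P_{\Sigma_1}$ is an $L_m(SUP^h)$-observer and an $L_m(SUP^k)$-observer. If $P_{\Sigma_1}(SUP^h)\parallel P_{\Sigma_1}(SUP^k)$ is nonblocking, no deconflicting module is needed. Otherwise choose $\Sigma_{CR}$ with $\Sigma_1\subseteq\Sigma_{CR}\subseteq\Sigma_{J_h\cup J_k}$ such that $P_{\Sigma_{CR}}$ is an $L_m(SUP^h)$-observer, an $L_m(SUP^k)$-observer and OCC for $L(A_i)$ for all $i\in J_h\cup J_k$; let $CR=\mathrm{Supcon}(G,P_{\Sigma_{CR}}(SUP^h)\parallel P_{\Sigma_{CR}}(SUP^k))$, where $G$ is the one-state automaton that generates and marks $\Sigma_{CR}^*$; each agent $A_i$, $i\in J_h\cup J_k$, with $\Sigma^{CR}\cap\Sigma^{A_i}\neq\emptyset$ receives as deconflicting module a result of $CMreduce(CR,A_i)$, and the other agents receive none. **Theorem.** Let $\mathcal N^h_1,\mathcal N^k_1$ be two basic subnets. For $i\in J_h\cup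 J_k$ let $CM_i$ be the synchronous product of all modules computed for $A_i$: $S^h_i$ (if $i\in J_h$), $S^k_i$ (if $i\in J_k$) and the deconflicting module (if there is one), for arbitrary outcomes of the procedures above. Then $$\parallel_{i\in J_h\cup J_k}(A_i\parallel CM_i)\ \equiv\ SUP^{\{h,k\}}=\mathrm{Supcon}(C^h\parallel C^k,\;A_{J_h}\parallel A_{J_k}).$$ In particular the coordinated system is nonblocking, and its marked language is the supremal controllable sublanguage of $L_m(A_{J_h}\parallel A_{J_k}\parallel C^h\parallel C^k)$. -/

import Mathlib

/-! Discrete-event agents as finite automata, supervisory-control notions (controllability,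
observability, supremal controllable sublanguages, observers, output control consistency),
distributed constraint specification networks, and the two synthesis procedures. -/

universe u v

namespace DES

variable {E : Type u} [DecidableEq E]

/-! ### Languages -/

/-- Prefix closure of a language. -/
def prefixClosure (L : Set (List E)) : Set (List E) :=
  {s | ∃ t ∈ L, s <+: t}

/-- Natural projection onto the event set `D`: erase every event that is not in `D`. -/
def proj (D : Finset E) (s : List E) : List E :=
  s.filter (fun e => decide (e ∈ D))

/-! ### Automata -/

/-- A finite deterministic automaton with a partial transition function, over a finite event set.
`init = none` encodes the empty automaton (no string is generated), which is needed as the result of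
a supervisor synthesis without solution. -/
structure Automaton (E : Type u) where
  State : Type v
  finite : Finite State
  alphabet : Finset E
  step : E → State → Option State
  step_mem : ∀ e q q', step e q = some q' → e ∈ alphabet
  init : Option State
  marked : Set State

namespace Automaton

/-- The state reached from `q` by a string, if defined. -/
def runFrom (A : Automaton.{u, v} E) : A.State → List E → Option A.State
  | q, [] => some q
  | q, e :: s => (A.step e q).bind (fun q' => runFrom A q' s)

/-- The state reached from the initial state by a string, if defined. -/
def run (A : Automaton.{u, v} E) (s : List E) : Option A.State :=
  A.init.bind (fun q => A.runFrom q s)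

/-- The generated (prefix-closed) language `L(A)`. -/
def lang (A : Automaton.{u, v} E) : Set (List E) :=
  {s | ∃ q, A.run s = some q}

/-- The marked language `L_m(A)`. -/
def markedLang (A : Automaton.{u, v} E) : Set (List E) :=
  {s | ∃ q ∈ A.marked, A.run s = some q}

/-- Every generated string can be completed to a marked string. -/
def Nonblocking (A : Automaton.{u, v} E) : Prop :=
  prefixClosure A.markedLang = A.lang

/-- Equivalence of automata: same event set, same generated and same marked language. -/
def Equivalent (A B : Automaton.{u, v} E) : Prop :=
  A.alphabet = B.alphabet ∧ A.lang = B.lang ∧ A.markedLang = B.markedLang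

/-- Transitions of the synchronous product: shared events are executed jointly, the other events
are interleaved. -/
def syncStep (A B : Automaton.{u, v} E) (e : E) (p : A.State × B.State) :
    Option (A.State × B.State) :=
  if e ∈ A.alphabet then
    if e ∈ B.alphabet then
      (A.step e p.1).bind (fun x => (B.step e p.2).map (fun y => (x, y)))
    else (A.step e p.1).map (fun x => (x, p.2))
  else (B.step e p.2).map (fun y => (p.1, y))

/-- The synchronous product `A ∥ B`. -/
abbrev sync (A B : Automaton.{u, v} E) : Automaton.{u, v} E where
  State := A.State × B.State
  finite := by
    have := A.finite
    have := B.finite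
    infer_instance
  alphabet := A.alphabet ∪ B.alphabet
  step := syncStep A B
  step_mem := by
    intro e p p' h
    unfold syncStep at h
    by_cases hA : e ∈ A.alphabet
    · exact Finset.mem_union_left _ hA
    · rw [if_neg hA, Option.map_eq_some_iff] at h
      obtain ⟨y, hy, -⟩ := h
      exact Finset.mem_union_right _ (B.step_mem _ _ _ hy)
  init := A.init.bind (fun x => B.init.map (fun y => (x, y)))
  marked := {p | p.1 ∈ A.marked ∧ p.2 ∈ B.marked}

/-- The one-state automaton over `D` that generates and marks `D*`. -/
abbrev oneState (D : Finset E) : Automaton.{u, v} E where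
  State := PUnit
  finite := inferInstance
  alphabet := D
  step := fun e q => if e ∈ D then some q else none
  step_mem := by
    intro e q q' h
    by_contra hD
    simp [hD] at h
  init := some PUnit.unit
  marked := Set.univ

/-- Synchronous product of a list of automata. The one-state automaton with no event, which is the
unit of `∥`, is the product of the empty list. -/
def syncList (l : List (Automaton.{u, v} E)) : Automaton.{u, v} E :=
  l.foldr sync (oneState ∅)

/-- Synchronous product `∥_{i ∈ J} A_i` of an indexed family. -/
def syncOver {n : ℕ} (J : Finset (Fin n)) (A : Fin n → Automaton.{u, v} E) :
    Automaton.{u, v} E :=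
  syncList (((List.finRange n).filter (fun i => decide (i ∈ J))).map A)

/-- States reachable from some state of `q` by a string whose projection onto `D` is `t`. -/
def reach (A : Automaton.{u, v} E) (D : Finset E) (q : Set A.State) (t : List E) :
    Set A.State :=
  {y | ∃ x ∈ q, ∃ w : List E, proj D w = t ∧ A.runFrom x w = some y}

open Classical in
/-- The projected automaton `P_D(A)`, by subset construction: it generates `P_D(L(A))` and marks
`P_D(L_m(A))`, over the event set `Σ^A ∩ D`. -/
noncomputable abbrev project (A : Automaton.{u, v} E) (D : Finset E) : Automaton.{u, v} E where
  State := Set A.State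
  finite := by
    have := A.finite
    infer_instance
  alphabet := A.alphabet ∩ D
  step := fun e q =>
    if e ∈ A.alphabet ∩ D ∧ (A.reach D q [e]).Nonempty then some (A.reach D q [e]) else none
  step_mem := by
    intro e q q' h
    by_contra hD
    rw [if_neg (fun hc => hD hc.1)] at h
    exact absurd h (by simp)
  init := A.init.map (fun x => A.reach D {x} [])
  marked := {q | ∃ x ∈ q, x ∈ A.marked}

/-- Add to every state a self-loop for each event outside `D` that is not defined there, so that
only events of `D` can ever be disabled. -/
abbrev enableOutside (A : Automaton.{u, v} E) (D : Finset E) : Automaton.{u, v} E where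
  State := A.State
  finite := A.finite
  alphabet := A.alphabet
  step := fun e q =>
    (A.step e q).or (if e ∈ A.alphabet \ D then some q else none)
  step_mem := by
    intro e q q' h
    rcases hs : A.step e q with _ | x
    · rw [hs, Option.none_or] at h
      by_contra hD
      have : e ∉ A.alphabet \ D := fun hc => hD (Finset.mem_sdiff.1 hc).1
      simp [this] at h
    · exact A.step_mem _ _ _ hs
  init := A.init
  marked := A.marked

end Automaton

open Automaton

/-! ### Supervisory-control notions; `Sc` is the set of controllable events -/

/-- `K ⊆ L(A)` is controllable: no uncontrollable event possible in `A` leaves the prefix closure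
of `K`. -/
def Controllable (K : Set (List E)) (A : Automaton.{u, v} E) (Sc : Finset E) : Prop :=
  K ⊆ A.lang ∧ ∀ s ∈ prefixClosure K, ∀ e ∈ A.alphabet \ Sc,
    s ++ [e] ∈ A.lang → s ++ [e] ∈ prefixClosure K

/-- `K ⊆ L_m(A)` is observable with respect to `A` and the projection onto `D`. -/
def Observable (K : Set (List E)) (A : Automaton.{u, v} E) (D : Finset E) : Prop :=
  K ⊆ A.markedLang ∧ ∀ s s' : List E, proj D s = proj D s' →
    (∀ e ∈ A.alphabet, s ++ [e] ∈ prefixClosure K → s' ∈ prefixClosure K →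
      s' ++ [e] ∈ A.lang → s' ++ [e] ∈ prefixClosure K) ∧
    (s ∈ K → s' ∈ prefixClosure K ∩ A.markedLang → s' ∈ K)

/-- The supremal controllable sublanguage of `M`. -/
def supC (M : Set (List E)) (A : Automaton.{u, v} E) (Sc : Finset E) : Set (List E) :=
  ⋃₀ {K | K ⊆ M ∧ Controllable K A Sc}

/-- `S` is (a representative of) `Supcon(C, A)`: a nonblocking automaton over the events of `A`
marking the supremal controllable sublanguage of the strings marked by `A` that respect `C`.
Such an `S` is unique up to `Equivalent`. -/
def IsSupcon (C A : Automaton.{u, v} E) (Sc : Finset E) (S : Automaton.{u, v} E) : Prop :=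
  S.alphabet = A.alphabet ∧ S.Nonblocking ∧
    S.markedLang = supC (A.sync C).markedLang A Sc

/-- The projection onto `D` is an `L_m(A)`-observer. -/
def IsObserver (A : Automaton.{u, v} E) (D : Finset E) : Prop :=
  ∀ t ∈ proj D '' A.markedLang, ∀ s ∈ A.lang, proj D s <+: t →
    ∃ w : List E, s ++ w ∈ A.markedLang ∧ proj D (s ++ w) = t

/-- The projection onto `D` is output control consistent (OCC) for `L(A)`. -/
def IsOCC (A : Automaton.{u, v} E) (D Sc : Finset E) : Prop :=
  ∀ (s w : List E) (e : E), s ++ w ++ [e] ∈ A.lang →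
    (s = [] ∨ ∃ (r : List E) (d : E), d ∈ D ∧ s = r ++ [d]) →
    e ∈ D → e ∉ Sc → (∀ x ∈ w, x ∉ D) → ∀ x ∈ w, x ∉ Sc

/-! ### Distributed constraint specification networks -/

/-- A distributed constraint specification network: `n` agents with pairwise disjoint event sets
and `m` constraints `C k`, each for the agent group `J k`. The controllable events of agent `i` are
the events of `agent i` that lie in `ctrl`. -/
structure DCSN (E : Type u) [DecidableEq E] (n m : ℕ) where
  two_le : 2 ≤ n
  one_le : 1 ≤ m
  agent : Fin n → Automaton.{u, v} E
  agent_nonblocking : ∀ i, (agent i).Nonblocking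
  agent_disjoint : ∀ i j, i ≠ j → Disjoint (agent i).alphabet (agent j).alphabet
  ctrl : Finset E
  J : Fin m → Finset (Fin n)
  J_nonempty : ∀ k, (J k).Nonempty
  C : Fin m → Automaton.{u, v} E
  C_relevant : ∀ k, ∀ i ∈ J k, ((agent i).alphabet ∩ (C k).alphabet).Nonempty
  C_alphabet : ∀ k, (C k).alphabet ⊆ (J k).biUnion (fun i => (agent i).alphabet)

namespace DCSN

variable {n m : ℕ}

/-- The free interaction `A_J` of the agents of a group. -/
def group (N : DCSN.{u, v} E n m) (J : Finset (Fin n)) : Automaton.{u, v} E :=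
  syncOver J N.agent

/-- All events of the agents of a group. -/
def events (N : DCSN.{u, v} E n m) (J : Finset (Fin n)) : Finset E :=
  J.biUnion (fun i => (N.agent i).alphabet)

/-- `K` is coordinable with respect to `A_J` and the communication set `D`. -/
def Coordinable (N : DCSN.{u, v} E n m) (J : Finset (Fin n)) (K : Set (List E))
    (D : Finset E) : Prop :=
  Controllable K (N.group J) N.ctrl ∧
    ∀ i ∈ J, Observable K (N.group J) ((N.agent i).alphabet ∪ D)

/-- `D` is a communication set of minimal cardinality for `K` and the group `J`. -/
def IsMinSysComSet (N : DCSN.{u, v} E n m) (J : Finset (Fin n)) (K : Set (List E))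
    (D : Finset E) : Prop :=
  D ⊆ N.events J ∧ N.Coordinable J K D ∧
    ∀ D' ⊆ N.events J, N.Coordinable J K D' → D.card ≤ D'.card

/-- The coordination module for agent `i` built from `S` and the set `D` of events visible to the
agent: the projection of `S` onto `D`, completed by self-loops so that the agent never disables
anything but its own controllable events. -/
noncomputable def localCM (N : DCSN.{u, v} E n m) (i : Fin n) (S : Automaton.{u, v} E)
    (D : Finset E) : Automaton.{u, v} E :=
  (S.project D).enableOutside ((N.agent i).alphabet ∩ N.ctrl)

/-- `S'` is a possible result of replacing the module `S` of agent `i` by a reduced one: it achieves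
the same behavior together with the agent. -/
def IsCMReduce (N : DCSN.{u, v} E n m) (i : Fin n) (S S' : Automaton.{u, v} E) : Prop :=
  ((N.agent i).sync S').Equivalent ((N.agent i).sync S)

/-- `S i`, `i ∈ J k`, are modules computed by the basic subnet synthesis for constraint `k`. -/
def CMBasicSubnet (N : DCSN.{u, v} E n m) (k : Fin m) (S : Fin n → Automaton.{u, v} E) : Prop :=
  ∃ (SUP : Automaton.{u, v} E) (D : Finset E),
    IsSupcon (N.C k) (N.group (N.J k)) N.ctrl SUP ∧
    N.IsMinSysComSet (N.J k) SUP.markedLang D ∧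
    ∀ i ∈ N.J k, N.IsCMReduce i (N.localCM i SUP ((N.agent i).alphabet ∪ D)) (S i)

/-- `T i`, `i ∈ J h ∪ J k`, are the deconflicting modules (`none`: no module needed) computed by
the conflict resolution of the basic subnets `h` and `k`: first the nonconflict test on the
abstractions to `D₁`; if it fails, a conflict resolution `CR` computed on the abstractions to the
enlarged set `D₂` and then reduced for every agent that shares events with it. -/
def DeconflictBasicSubnet (N : DCSN.{u, v} E n m) (h k : Fin m)
    (T : Fin n → Option (Automaton.{u, v} E)) : Prop :=
  ∃ (SUPh SUPk : Automaton.{u, v} E) (D₁ : Finset E),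
    IsSupcon (N.C h) (N.group (N.J h)) N.ctrl SUPh ∧
    IsSupcon (N.C k) (N.group (N.J k)) N.ctrl SUPk ∧
    N.events (N.J h ∩ N.J k) ⊆ D₁ ∧ D₁ ⊆ N.events (N.J h ∪ N.J k) ∧
    IsObserver SUPh D₁ ∧ IsObserver SUPk D₁ ∧
    ((((SUPh.project D₁).sync (SUPk.project D₁)).Nonblocking ∧
        ∀ i ∈ N.J h ∪ N.J k, T i = none) ∨
      (¬ ((SUPh.project D₁).sync (SUPk.project D₁)).Nonblocking ∧
        ∃ (D₂ : Finset E) (CR : Automaton.{u, v} E),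
          D₁ ⊆ D₂ ∧ D₂ ⊆ N.events (N.J h ∪ N.J k) ∧
          IsObserver SUPh D₂ ∧ IsObserver SUPk D₂ ∧
          (∀ i ∈ N.J h ∪ N.J k, IsOCC (N.agent i) D₂ N.ctrl) ∧
          IsSupcon (oneState D₂) ((SUPh.project D₂).sync (SUPk.project D₂)) N.ctrl CR ∧
          ∀ i ∈ N.J h ∪ N.J k,
            ((CR.alphabet ∩ (N.agent i).alphabet).Nonempty →
              ∃ S, T i = some S ∧ N.IsCMReduce i CR S) ∧
            (¬ (CR.alphabet ∩ (N.agent i).alphabet).Nonempty → T i = none)))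

/-- The product `CM_i` of all modules of agent `i`: the local ones for `h` and `k` (where the agent
belongs to the group) and the deconflicting one (if any). -/
def totalCM (N : DCSN.{u, v} E n m) (h k : Fin m) (Sh Sk : Fin n → Automaton.{u, v} E)
    (T : Fin n → Option (Automaton.{u, v} E)) (i : Fin n) : Automaton.{u, v} E :=
  syncList ((if i ∈ N.J h then [Sh i] else []) ++ (if i ∈ N.J k then [Sk i] else []) ++
    (T i).toList)

/-- The coordinated system `∥_{i ∈ J h ∪ J k} (A_i ∥ CM_i)`. -/
def coordinated (N : DCSN.{u, v} E n m) (h k : Fin m) (Sh Sk : Fin n → Automaton.{u, v} E)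
    (T : Fin n → Option (Automaton.{u, v} E)) : Automaton.{u, v} E :=
  syncOver (N.J h ∪ N.J k) (fun i => (N.agent i).sync (N.totalCM h k Sh Sk T i))

end DCSN

end DES

/-! Write `A.Generates s` (`A.Marks s`) if the part of a string `s` that concerns `A` is generated
(marked) by `A`. A synchronous product generates or marks `s` exactly if all its components do, so
the claim becomes a comparison of conjunctions of such conditions.

*Basic subnets.* The agents of a group with their local modules behave like the centralized
supervisor (`generates_localCM_iff`, `marks_localCM_iff`). By induction on the string, an
uncontrollable event leads to no disagreement because the supervised behavior is controllable; a
controllable event belongs to exactly one agent, whose module has no self-loop for it, so the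
decision made on the projected string is right by observability. Reduced modules may be replaced by
unreduced ones because they are only used together with their agent. The coordinated system is
therefore the product of `SUP^h`, `SUP^k` and, if there is one, the conflict resolution.

*Conflict resolution.* Let `B` be the product of the abstractions of `SUP^h` and `SUP^k`, and `R` a
nonblocking automaton that is controllable for `B`. Then `SUP^h ∥ SUP^k ∥ R` is nonblocking, since
the observer properties lift every marked continuation in `B` (`exists_marked_extension`), and its
marked language is controllable. It is the supremal one as soon as `R` marks the abstraction of
every controllable behavior `K` of the composed agents (`isSupcon_of_resolution`): the part of `K`
that concerns one group is controllable for that group, hence marked by its supervisor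
(`marks_of_controllable`). If the abstractions do not conflict, `R = B` will do. Otherwise `R = CR`
will, because the abstraction of `K` is controllable for `B` (`controllable_proj_of_isOCC`): if `B`
can execute an uncontrollable event, the observer property yields a lift of it, from which the
events of the other agents can be removed, and output control consistency makes the remaining
events uncontrollable, so that they do not leave the closure of `K`
(`exists_uncontrollable_lift`). -/

namespace DES

open Automaton

variable {E : Type u}

/-! ### Prefix closures and runs -/

theorem prefixClosure_mono {K L : Set (List E)} (h : K ⊆ L) : prefixClosure K ⊆ prefixClosure L :=
  fun _ ⟨t, ht, hs⟩ => ⟨t, h ht, hs⟩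

theorem subset_prefixClosure (K : Set (List E)) : K ⊆ prefixClosure K :=
  fun s hs => ⟨s, hs, List.prefix_rfl⟩

namespace Automaton

theorem runFrom_append (A : Automaton.{u, v} E) (q : A.State) (s t : List E) :
    A.runFrom q (s ++ t) = (A.runFrom q s).bind (fun x => A.runFrom x t) := by
  induction s generalizing q with
  | nil => rfl
  | cons e s ih =>
    simp only [List.cons_append, runFrom, Option.bind_assoc]
    congr 1
    funext x
    exact ih x

theorem run_append (A : Automaton.{u, v} E) (s t : List E) :
    A.run (s ++ t) = (A.run s).bind (fun x => A.runFrom x t) := by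
  simp only [run, runFrom_append, Option.bind_assoc]

theorem runFrom_singleton (A : Automaton.{u, v} E) (q : A.State) (e : E) :
    A.runFrom q [e] = A.step e q := by
  simp [runFrom]

theorem run_snoc (A : Automaton.{u, v} E) (s : List E) (e : E) :
    A.run (s ++ [e]) = (A.run s).bind (A.step e) := by
  simp only [run_append, runFrom_singleton]

theorem mem_alphabet_of_runFrom {A : Automaton.{u, v} E} {q q' : A.State} {s : List E}
    (h : A.runFrom q s = some q') : ∀ e ∈ s, e ∈ A.alphabet := by
  induction s generalizing q with
  | nil => simp
  | cons e s ih =>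
    obtain ⟨x, hx, hx'⟩ := Option.bind_eq_some_iff.1 h
    intro a ha
    rcases List.mem_cons.1 ha with rfl | ha
    · exact A.step_mem _ _ _ hx
    · exact ih hx' a ha

theorem mem_alphabet_of_mem_lang {A : Automaton.{u, v} E} {s : List E} (h : s ∈ A.lang) :
    ∀ e ∈ s, e ∈ A.alphabet := by
  obtain ⟨q, hq⟩ := h
  obtain ⟨x, -, hx⟩ := Option.bind_eq_some_iff.1 hq
  exact mem_alphabet_of_runFrom hx

theorem mem_lang_of_prefix {A : Automaton.{u, v} E} {s t : List E} (h : s <+: t)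
    (ht : t ∈ A.lang) : s ∈ A.lang := by
  obtain ⟨u, rfl⟩ := h
  obtain ⟨q, hq⟩ := ht
  rw [run_append] at hq
  obtain ⟨x, hx, -⟩ := Option.bind_eq_some_iff.1 hq
  exact ⟨x, hx⟩

theorem markedLang_subset_lang (A : Automaton.{u, v} E) : A.markedLang ⊆ A.lang :=
  fun _ ⟨q, _, hq⟩ => ⟨q, hq⟩

theorem prefixClosure_markedLang_subset (A : Automaton.{u, v} E) :
    prefixClosure A.markedLang ⊆ A.lang :=
  fun _ ⟨_, ht, hs⟩ => mem_lang_of_prefix hs (A.markedLang_subset_lang ht)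

theorem nil_mem_lang {A : Automaton.{u, v} E} : [] ∈ A.lang ↔ A.init.isSome := by
  rw [Option.isSome_iff_exists]
  simp [lang, run, runFrom]

theorem Nonblocking.exists_append {A : Automaton.{u, v} E} (h : A.Nonblocking) {s : List E}
    (hs : s ∈ A.lang) : ∃ t, s ++ t ∈ A.markedLang := by
  rw [← h] at hs
  obtain ⟨_, ht, t, rfl⟩ := hs
  exact ⟨t, ht⟩

end Automaton

variable [DecidableEq E]

/-! ### Projections of strings -/

theorem proj_append (D : Finset E) (s t : List E) : proj D (s ++ t) = proj D s ++ proj D t :=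
  List.filter_append ..

theorem proj_cons_of_mem {D : Finset E} {e : E} (h : e ∈ D) (s : List E) :
    proj D (e :: s) = e :: proj D s := by
  simp [proj, h]

theorem proj_cons_of_notMem {D : Finset E} {e : E} (h : e ∉ D) (s : List E) :
    proj D (e :: s) = proj D s := by
  simp [proj, h]

theorem proj_snoc_of_mem {D : Finset E} {e : E} (h : e ∈ D) (s : List E) :
    proj D (s ++ [e]) = proj D s ++ [e] := by
  simp [proj, h]

theorem proj_snoc_of_notMem {D : Finset E} {e : E} (h : e ∉ D) (s : List E) :
    proj D (s ++ [e]) = proj D s := by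
  simp [proj, h]

theorem mem_proj {D : Finset E} {e : E} {s : List E} : e ∈ proj D s ↔ e ∈ s ∧ e ∈ D := by
  simp [proj]

theorem proj_eq_self {D : Finset E} {s : List E} (h : ∀ e ∈ s, e ∈ D) : proj D s = s := by
  simpa [proj, List.filter_eq_self] using h

theorem proj_eq_nil {D : Finset E} {s : List E} : proj D s = [] ↔ ∀ e ∈ s, e ∉ D := by
  simp [proj, List.filter_eq_nil_iff]

theorem proj_congr {D D' : Finset E} {s : List E} (h : ∀ e ∈ s, (e ∈ D ↔ e ∈ D')) :
    proj D s = proj D' s :=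
  List.filter_congr fun e he => by simp [h e he]

theorem proj_proj (D D' : Finset E) (s : List E) : proj D (proj D' s) = proj (D ∩ D') s := by
  simp [proj, List.filter_filter]

theorem proj_proj_of_subset {D D' : Finset E} (h : D ⊆ D') (s : List E) :
    proj D (proj D' s) = proj D s := by
  rw [proj_proj, Finset.inter_eq_left.2 h]

theorem proj_prefix {s t : List E} (D : Finset E) (h : s <+: t) : proj D s <+: proj D t :=
  h.filter _

theorem proj_eq_append {D : Finset E} {w t u : List E} (h : proj D w = t ++ u) :
    ∃ w₁ w₂, w = w₁ ++ w₂ ∧ proj D w₁ = t ∧ proj D w₂ = u :=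
  List.filter_eq_append_iff.1 h

theorem proj_eq_cons {D : Finset E} {w u : List E} {e : E} (h : proj D w = e :: u) :
    ∃ w₁ w₂, w = w₁ ++ e :: w₂ ∧ (∀ x ∈ w₁, x ∉ D) ∧ e ∈ D ∧ proj D w₂ = u := by
  obtain ⟨w₁, w₂, h₁, h₂, h₃, h₄⟩ := List.filter_eq_cons_iff.1 h
  exact ⟨w₁, w₂, h₁, by simpa using h₂, by simpa using h₃, h₄⟩

theorem prefixClosure_proj (D : Finset E) (K : Set (List E)) :
    prefixClosure (proj D '' K) = proj D '' prefixClosure K := by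
  ext s
  constructor
  · rintro ⟨_, ⟨t, ht, rfl⟩, u, hu⟩
    obtain ⟨w₁, w₂, rfl, h₁, -⟩ := proj_eq_append hu.symm
    exact ⟨w₁, ⟨_, ht, w₂, rfl⟩, h₁⟩
  · rintro ⟨s, ⟨t, ht, hs⟩, rfl⟩
    exact ⟨_, ⟨t, ht, rfl⟩, proj_prefix D hs⟩

/-- Strings over `A` and over `B` that agree on the shared events have a common interleaving. -/
theorem exists_interleaving {A B : Finset E} {u v : List E} (hu : ∀ e ∈ u, e ∈ A)
    (hv : ∀ e ∈ v, e ∈ B) (h : proj B u = proj A v) :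
    ∃ w : List E, (∀ e ∈ w, e ∈ A ∪ B) ∧ proj A w = u ∧ proj B w = v := by
  induction u generalizing v with
  | nil => exact ⟨v, fun e he => Finset.mem_union_right _ (hv e he), h.symm, proj_eq_self hv⟩
  | cons a u ih =>
    have ha : a ∈ A := hu a (by simp)
    have hu' : ∀ e ∈ u, e ∈ A := fun e he => hu e (by simp [he])
    by_cases hB : a ∈ B
    · rw [proj_cons_of_mem hB] at h
      obtain ⟨v₁, v₂, rfl, hv₁, -, hv₂⟩ := proj_eq_cons h.symm
      obtain ⟨w, hw, hwA, hwB⟩ := ih hu' (fun e he => hv e (by simp [he])) hv₂.symm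
      have hv₁B : ∀ e ∈ v₁, e ∈ B := fun e he => hv e (by simp [he])
      refine ⟨v₁ ++ a :: w, ?_, ?_, ?_⟩
      · intro e he
        rcases List.mem_append.1 he with he | he
        · exact Finset.mem_union_right _ (hv₁B e he)
        · rcases List.mem_cons.1 he with rfl | he
          · exact Finset.mem_union_left _ ha
          · exact hw e he
      · rw [proj_append, proj_eq_nil.2 hv₁, proj_cons_of_mem ha, hwA, List.nil_append]
      · rw [proj_append, proj_eq_self hv₁B, proj_cons_of_mem hB, hwB]
    · rw [proj_cons_of_notMem hB] at h
      obtain ⟨w, hw, hwA, hwB⟩ := ih hu' hv h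
      refine ⟨a :: w, ?_, by rw [proj_cons_of_mem ha, hwA], by rw [proj_cons_of_notMem hB, hwB]⟩
      intro e he
      rcases List.mem_cons.1 he with rfl | he
      · exact Finset.mem_union_left _ ha
      · exact hw e he

/-- Split a string after its last event of `D`; this is the form of string that `IsOCC` is about. -/
theorem exists_split_last (D : Finset E) (s : List E) :
    ∃ r v : List E, s = r ++ v ∧ (r = [] ∨ ∃ (p : List E) (d : E), d ∈ D ∧ r = p ++ [d]) ∧
      ∀ x ∈ v, x ∉ D := by
  induction s using List.reverseRecOn with
  | nil => exact ⟨[], [], rfl, Or.inl rfl, by simp⟩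
  | append_singleton s e ih =>
    by_cases he : e ∈ D
    · exact ⟨s ++ [e], [], by simp, Or.inr ⟨s, e, he, rfl⟩, by simp⟩
    · obtain ⟨r, v, rfl, hr, hv⟩ := ih
      refine ⟨r, v ++ [e], by simp, hr, fun x hx => ?_⟩
      rcases List.mem_append.1 hx with hx | hx
      · exact hv x hx
      · rwa [List.mem_singleton.1 hx]

/-! ### Participation in a composed string -/

namespace Automaton

/-- `A` takes part in the string `s` of a composed system without blocking it: the part of `s` that
concerns `A` is generated by `A`. Unlike membership in `A.lang`, this makes sense for strings over
any larger event set, and turns `∥` into a conjunction. -/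
def Generates (A : Automaton.{u, v} E) (s : List E) : Prop :=
  proj A.alphabet s ∈ A.lang

/-- The part of the string `s` of a composed system that concerns `A` is marked by `A`. -/
def Marks (A : Automaton.{u, v} E) (s : List E) : Prop :=
  proj A.alphabet s ∈ A.markedLang

theorem Marks.generates {A : Automaton.{u, v} E} {s : List E} (h : A.Marks s) : A.Generates s :=
  A.markedLang_subset_lang h

theorem Generates.of_prefix {A : Automaton.{u, v} E} {s t : List E} (ht : A.Generates t)
    (h : s <+: t) : A.Generates s :=
  mem_lang_of_prefix (proj_prefix _ h) ht

theorem mem_lang_iff {A : Automaton.{u, v} E} {s : List E} :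
    s ∈ A.lang ↔ (∀ e ∈ s, e ∈ A.alphabet) ∧ A.Generates s := by
  constructor
  · intro h
    have := mem_alphabet_of_mem_lang h
    exact ⟨this, by rwa [Generates, proj_eq_self this]⟩
  · rintro ⟨h, hs⟩
    rwa [Generates, proj_eq_self h] at hs

theorem mem_markedLang_iff {A : Automaton.{u, v} E} {s : List E} :
    s ∈ A.markedLang ↔ (∀ e ∈ s, e ∈ A.alphabet) ∧ A.Marks s := by
  constructor
  · intro h
    have := mem_alphabet_of_mem_lang (A.markedLang_subset_lang h)
    exact ⟨this, by rwa [Marks, proj_eq_self this]⟩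
  · rintro ⟨h, hs⟩
    rwa [Marks, proj_eq_self h] at hs

theorem generates_proj {A : Automaton.{u, v} E} {D : Finset E} (h : A.alphabet ⊆ D)
    (s : List E) : A.Generates (proj D s) ↔ A.Generates s := by
  rw [Generates, Generates, proj_proj_of_subset h]

theorem marks_proj {A : Automaton.{u, v} E} {D : Finset E} (h : A.alphabet ⊆ D)
    (s : List E) : A.Marks (proj D s) ↔ A.Marks s := by
  rw [Marks, Marks, proj_proj_of_subset h]

theorem Equivalent.generates_iff {A B : Automaton.{u, v} E} (h : A.Equivalent B) (s : List E) :
    A.Generates s ↔ B.Generates s := by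
  rw [Generates, Generates, h.1, h.2.1]

theorem Equivalent.marks_iff {A B : Automaton.{u, v} E} (h : A.Equivalent B) (s : List E) :
    A.Marks s ↔ B.Marks s := by
  rw [Marks, Marks, h.1, h.2.2]

/-! ### Synchronous products -/

theorem run_sync (A B : Automaton.{u, v} E) {s : List E}
    (hs : ∀ e ∈ s, e ∈ A.alphabet ∪ B.alphabet) :
    (A.sync B).run s = (A.run (proj A.alphabet s)).bind
      (fun x => (B.run (proj B.alphabet s)).map (fun y => (x, y))) := by
  induction s using List.reverseRecOn with
  | nil => simp [run, runFrom, proj]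
  | append_singleton s e ih =>
    rw [run_snoc, ih fun a ha => hs a (by simp [ha])]
    have he : e ∈ A.alphabet ∪ B.alphabet := hs e (by simp)
    by_cases hA : e ∈ A.alphabet <;> by_cases hB : e ∈ B.alphabet
    · rw [proj_snoc_of_mem hA, proj_snoc_of_mem hB, run_snoc, run_snoc]
      cases A.run (proj A.alphabet s) <;> cases B.run (proj B.alphabet s) <;>
        simp [syncStep, hA, hB]
    · rw [proj_snoc_of_mem hA, proj_snoc_of_notMem hB, run_snoc]
      cases A.run (proj A.alphabet s) <;> cases B.run (proj B.alphabet s) <;>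
        simp [syncStep, hA, hB, Option.map_eq_bind]
    · rw [proj_snoc_of_notMem hA, proj_snoc_of_mem hB, run_snoc]
      cases A.run (proj A.alphabet s) <;> cases B.run (proj B.alphabet s) <;>
        simp [syncStep, hA]
    · simp [hA, hB] at he

theorem generates_sync {A B : Automaton.{u, v} E} {s : List E} :
    (A.sync B).Generates s ↔ A.Generates s ∧ B.Generates s := by
  have h := run_sync A B (s := proj (A.alphabet ∪ B.alphabet) s) fun e he => (mem_proj.1 he).2
  rw [proj_proj_of_subset Finset.subset_union_left,
    proj_proj_of_subset Finset.subset_union_right] at h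
  simp only [Generates, lang, Set.mem_ofPred_eq]
  rw [h]
  cases A.run (proj A.alphabet s) <;> cases B.run (proj B.alphabet s) <;> simp

theorem marks_sync {A B : Automaton.{u, v} E} {s : List E} :
    (A.sync B).Marks s ↔ A.Marks s ∧ B.Marks s := by
  have h := run_sync A B (s := proj (A.alphabet ∪ B.alphabet) s) fun e he => (mem_proj.1 he).2
  rw [proj_proj_of_subset Finset.subset_union_left,
    proj_proj_of_subset Finset.subset_union_right] at h
  simp only [Marks, markedLang, Set.mem_ofPred_eq]
  rw [h]
  cases A.run (proj A.alphabet s) <;> cases B.run (proj B.alphabet s) <;> simp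

theorem generates_syncList {l : List (Automaton.{u, v} E)} {s : List E} :
    (syncList l).Generates s ↔ ∀ A ∈ l, A.Generates s := by
  induction l with
  | nil => simp [syncList, Generates, proj, lang, run, runFrom]
  | cons A l ih =>
    rw [List.forall_mem_cons, ← ih]
    exact generates_sync

theorem marks_syncList {l : List (Automaton.{u, v} E)} {s : List E} :
    (syncList l).Marks s ↔ ∀ A ∈ l, A.Marks s := by
  induction l with
  | nil => simpa [syncList, Marks, proj, markedLang, run, runFrom] using ⟨PUnit.unit, trivial⟩
  | cons A l ih =>
    rw [List.forall_mem_cons, ← ih]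
    exact marks_sync

theorem mem_alphabet_syncList {l : List (Automaton.{u, v} E)} {e : E} :
    e ∈ (syncList l).alphabet ↔ ∃ A ∈ l, e ∈ A.alphabet := by
  induction l with
  | nil => simp [syncList]
  | cons A l ih =>
    rw [List.exists_mem_cons_iff, ← ih]
    exact Finset.mem_union

theorem generates_syncOver {n : ℕ} {J : Finset (Fin n)} {A : Fin n → Automaton.{u, v} E}
    {s : List E} : (syncOver J A).Generates s ↔ ∀ i ∈ J, (A i).Generates s := by
  simp [syncOver, generates_syncList]

theorem marks_syncOver {n : ℕ} {J : Finset (Fin n)} {A : Fin n → Automaton.{u, v} E}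
    {s : List E} : (syncOver J A).Marks s ↔ ∀ i ∈ J, (A i).Marks s := by
  simp [syncOver, marks_syncList]

theorem alphabet_syncOver {n : ℕ} (J : Finset (Fin n)) (A : Fin n → Automaton.{u, v} E) :
    (syncOver J A).alphabet = J.biUnion fun i => (A i).alphabet := by
  ext e
  simp [syncOver, mem_alphabet_syncList]

theorem marks_oneState (D : Finset E) (s : List E) : (oneState D : Automaton.{u, v} E).Marks s := by
  refine ⟨PUnit.unit, trivial, ?_⟩
  change (oneState D).run (proj D s) = some PUnit.unit
  induction s using List.reverseRecOn with
  | nil => rfl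
  | append_singleton s e ih =>
    by_cases he : e ∈ D
    · rw [proj_snoc_of_mem he, run_snoc, ih]
      exact if_pos he
    · rwa [proj_snoc_of_notMem he]

/-! ### Projected automata -/

theorem reach_reach (A : Automaton.{u, v} E) (D : Finset E) (q : Set A.State) (t u : List E) :
    A.reach D (A.reach D q t) u = A.reach D q (t ++ u) := by
  ext y
  constructor
  · rintro ⟨x, ⟨z, hz, w₁, rfl, h₁⟩, w₂, rfl, h₂⟩
    exact ⟨z, hz, w₁ ++ w₂, proj_append .., by rw [runFrom_append, h₁]; exact h₂⟩
  · rintro ⟨z, hz, w, hw, h⟩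
    obtain ⟨w₁, w₂, rfl, h₁, h₂⟩ := proj_eq_append hw
    rw [runFrom_append] at h
    obtain ⟨x, hx, hx'⟩ := Option.bind_eq_some_iff.1 h
    exact ⟨x, ⟨z, hz, w₁, h₁, hx⟩, w₂, h₂, hx'⟩

open Classical in
/-- From a state set closed under unobserved strings, the subset construction reaches the set of
all states compatible with the observed string. -/
theorem runFrom_project (A : Automaton.{u, v} E) (D : Finset E) {q : Set A.State}
    (hq : q.Nonempty) (hcl : A.reach D q [] = q) (t : List E) :
    (A.project D).runFrom q t =
      if (A.reach D q t).Nonempty then some (A.reach D q t) else none := by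
  induction t generalizing q with
  | nil => rw [hcl, if_pos hq]; rfl
  | cons e t ih =>
    by_cases h : (A.reach D q [e]).Nonempty
    · have he : e ∈ A.alphabet ∩ D := by
        obtain ⟨y, x, -, w, hw, hr⟩ := h
        have : e ∈ proj D w := by simp [hw]
        exact Finset.mem_inter.2
          ⟨mem_alphabet_of_runFrom hr e (mem_proj.1 this).1, (mem_proj.1 this).2⟩
      have hstep : (A.project D).step e q = some (A.reach D q [e]) := if_pos ⟨he, h⟩
      rw [runFrom, hstep, Option.bind_some, ih h (by rw [reach_reach]; rfl), reach_reach]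
      rfl
    · have hstep : (A.project D).step e q = none := if_neg fun hc => h hc.2
      have h' : ¬ (A.reach D q (e :: t)).Nonempty := by
        rw [← List.singleton_append, ← reach_reach]
        rintro ⟨y, x, hx, -⟩
        exact h ⟨x, hx⟩
      rw [runFrom, hstep, if_neg h']
      rfl

theorem run_project_eq_some {A : Automaton.{u, v} E} {D : Finset E} {t : List E}
    {q : Set A.State} :
    (A.project D).run t = some q ↔
      q.Nonempty ∧ q = {y | ∃ w, proj D w = t ∧ A.run w = some y} := by
  classical
  cases hi : A.init with
  | none =>
    have h : (A.project D).run t = none := by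
      change (A.init.map _).bind _ = none
      rw [hi]
      rfl
    have h' : ∀ w, A.run w = none := fun w => by rw [run, hi]; rfl
    rw [h]
    simp only [h', reduceCtorEq, and_false, exists_false, false_iff, not_and]
    rintro ⟨y, hy⟩ rfl
    exact hy
  | some x =>
    have h : (A.project D).run t = (A.project D).runFrom (A.reach D {x} []) t := by
      change (A.init.map _).bind _ = _
      rw [hi]
      rfl
    have hr : A.reach D {x} t = {y | ∃ w, proj D w = t ∧ A.run w = some y} := by
      ext y
      simp [reach, run, hi]
    have hne : (A.reach D {x} []).Nonempty := ⟨x, x, rfl, [], rfl, rfl⟩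
    have hcl : A.reach D (A.reach D {x} []) [] = A.reach D {x} [] := reach_reach ..
    rw [h, runFrom_project A D hne hcl, reach_reach,
      List.nil_append, hr]
    split_ifs with hne
    · rw [Option.some_inj]
      exact ⟨fun h => ⟨h ▸ hne, h.symm⟩, fun h => h.2.symm⟩
    · simp only [false_iff, not_and]
      rintro h1 rfl
      exact hne h1

theorem lang_project (A : Automaton.{u, v} E) (D : Finset E) :
    (A.project D).lang = proj D '' A.lang := by
  ext t
  constructor
  · rintro ⟨q, hq⟩
    obtain ⟨⟨y, hy⟩, rfl⟩ := run_project_eq_some.1 hq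
    obtain ⟨w, hw, hr⟩ := hy
    exact ⟨w, ⟨y, hr⟩, hw⟩
  · rintro ⟨w, ⟨y, hr⟩, hw⟩
    have hy : y ∈ {y | ∃ w, proj D w = t ∧ A.run w = some y} := ⟨w, hw, hr⟩
    exact ⟨_, run_project_eq_some.2 ⟨⟨y, hy⟩, rfl⟩⟩

theorem markedLang_project (A : Automaton.{u, v} E) (D : Finset E) :
    (A.project D).markedLang = proj D '' A.markedLang := by
  ext t
  constructor
  · rintro ⟨q, ⟨y, hy, hym⟩, hq⟩
    obtain ⟨-, rfl⟩ := run_project_eq_some.1 hq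
    obtain ⟨w, hw, hr⟩ := hy
    exact ⟨w, ⟨y, hym, hr⟩, hw⟩
  · rintro ⟨w, ⟨y, hym, hr⟩, hw⟩
    have hy : y ∈ {y | ∃ w, proj D w = t ∧ A.run w = some y} := ⟨w, hw, hr⟩
    exact ⟨_, ⟨y, hy, hym⟩, run_project_eq_some.2 ⟨⟨y, hy⟩, rfl⟩⟩

theorem Generates.project {A : Automaton.{u, v} E} {s : List E} (h : A.Generates s)
    (D : Finset E) : (A.project D).Generates s := by
  rw [Generates, lang_project]
  exact ⟨_, h, by rw [proj_proj, Finset.inter_comm]⟩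

theorem Marks.project {A : Automaton.{u, v} E} {s : List E} (h : A.Marks s)
    (D : Finset E) : (A.project D).Marks s := by
  rw [Marks, markedLang_project]
  exact ⟨_, h, by rw [proj_proj, Finset.inter_comm]⟩

/-! ### Completion by self-loops -/

theorem run_enableOutside {A : Automaton.{u, v} E} (D : Finset E) {s : List E} {q : A.State}
    (h : A.run s = some q) : (A.enableOutside D).run s = some q := by
  induction s using List.reverseRecOn generalizing q with
  | nil => exact h
  | append_singleton s e ih =>
    rw [run_snoc] at h
    obtain ⟨x, hx, hs⟩ := Option.bind_eq_some_iff.1 h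
    rw [run_snoc, ih hx]
    change (A.step e x).or _ = _
    rw [hs]
    rfl

theorem lang_subset_enableOutside (A : Automaton.{u, v} E) (D : Finset E) :
    A.lang ⊆ (A.enableOutside D).lang :=
  fun _ ⟨q, hq⟩ => ⟨q, run_enableOutside D hq⟩

theorem markedLang_subset_enableOutside (A : Automaton.{u, v} E) (D : Finset E) :
    A.markedLang ⊆ (A.enableOutside D).markedLang :=
  fun _ ⟨q, hm, hq⟩ => ⟨q, hm, run_enableOutside D hq⟩

theorem mem_markedLang_of_enableOutside {A : Automaton.{u, v} E} {D : Finset E} {s : List E}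
    (hs : s ∈ A.lang) (h : s ∈ (A.enableOutside D).markedLang) : s ∈ A.markedLang := by
  obtain ⟨q, hq⟩ := hs
  obtain ⟨q', hm, hq'⟩ := h
  rw [run_enableOutside D hq] at hq'
  cases hq'
  exact ⟨q, hm, hq⟩

/-- The added self-loops neither change the state reached by a string of `A` nor enable an event of
`D`. -/
theorem snoc_mem_lang_of_enableOutside {A : Automaton.{u, v} E} {D : Finset E} {s : List E} {e : E}
    (he : e ∈ D) (hs : s ∈ A.lang) (h : s ++ [e] ∈ (A.enableOutside D).lang) :
    s ++ [e] ∈ A.lang := by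
  obtain ⟨q, hq⟩ := hs
  obtain ⟨q', hq'⟩ := h
  rw [run_snoc, run_enableOutside D hq] at hq'
  refine ⟨q', ?_⟩
  rw [run_snoc, hq]
  change (A.step e q).or (if e ∈ A.alphabet \ D then some q else none) = some q' at hq'
  rwa [if_neg (by simp [he]), Option.or_none] at hq'

end Automaton

/-! ### Controllability and supremal controllable sublanguages -/

theorem Controllable.prefixClosure_subset {K : Set (List E)} {A : Automaton.{u, v} E}
    {Sc : Finset E} (h : Controllable K A Sc) : prefixClosure K ⊆ A.lang :=
  fun _ ⟨_, ht, hs⟩ => mem_lang_of_prefix hs (h.1 ht)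

theorem Controllable.append_mem {K : Set (List E)} {A : Automaton.{u, v} E} {Sc : Finset E}
    (h : Controllable K A Sc) {s w : List E} (hs : s ∈ prefixClosure K) (hw : ∀ e ∈ w, e ∉ Sc)
    (hl : s ++ w ∈ A.lang) : s ++ w ∈ prefixClosure K := by
  induction w using List.reverseRecOn with
  | nil => simpa using hs
  | append_singleton w e ih =>
    have hsw : s ++ w ∈ prefixClosure K :=
      ih (fun x hx => hw x (by simp [hx])) (mem_lang_of_prefix (by simp) hl)
    rw [← List.append_assoc] at hl ⊢
    exact h.2 _ hsw e
      (Finset.mem_sdiff.2 ⟨mem_alphabet_of_mem_lang hl e (by simp), hw e (by simp)⟩) hl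

theorem Controllable.congr {K : Set (List E)} {A B : Automaton.{u, v} E} {Sc : Finset E}
    (h : Controllable K A Sc) (ha : A.alphabet = B.alphabet) (hl : A.lang = B.lang) :
    Controllable K B Sc := by
  rw [Controllable, ← ha, ← hl]
  exact h

theorem supC_subset (M : Set (List E)) (A : Automaton.{u, v} E) (Sc : Finset E) :
    supC M A Sc ⊆ M :=
  Set.sUnion_subset fun _ hK => hK.1

theorem subset_supC {K M : Set (List E)} {A : Automaton.{u, v} E} {Sc : Finset E} (hM : K ⊆ M)
    (hK : Controllable K A Sc) : K ⊆ supC M A Sc :=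
  fun _ hs => ⟨K, ⟨hM, hK⟩, hs⟩

theorem controllable_supC (M : Set (List E)) (A : Automaton.{u, v} E) (Sc : Finset E) :
    Controllable (supC M A Sc) A Sc := by
  refine ⟨Set.sUnion_subset fun _ hK => hK.2.1, ?_⟩
  rintro s ⟨t, ⟨K, hK, ht⟩, hs⟩ e he hl
  exact prefixClosure_mono (subset_supC hK.1 hK.2) (hK.2.2 s ⟨t, ht, hs⟩ e he hl)

namespace IsSupcon

variable {C A S : Automaton.{u, v} E} {Sc : Finset E}

theorem controllable (h : IsSupcon C A Sc S) : Controllable S.markedLang A Sc := by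
  rw [h.2.2]
  exact controllable_supC ..

theorem marks (h : IsSupcon C A Sc S) (hC : C.alphabet ⊆ A.alphabet) {s : List E}
    (hs : S.Marks s) : A.Marks s ∧ C.Marks s := by
  rw [Marks, h.2.2, h.1] at hs
  have hm := marks_sync.1 (mem_markedLang_iff.1 (supC_subset _ _ _ hs)).2
  rwa [marks_proj subset_rfl, marks_proj hC] at hm

theorem equivalent {S' : Automaton.{u, v} E} (h : IsSupcon C A Sc S) (h' : IsSupcon C A Sc S') :
    S.Equivalent S' := by
  have hm : S.markedLang = S'.markedLang := h.2.2.trans h'.2.2.symm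
  exact ⟨h.1.trans h'.1.symm, by rw [← h.2.1, ← h'.2.1, hm], hm⟩

theorem lang_subset (h : IsSupcon C A Sc S) : S.lang ⊆ A.lang := by
  rw [← h.2.1]
  exact h.controllable.prefixClosure_subset

theorem generates (h : IsSupcon C A Sc S) {s : List E} (hs : S.Generates s) : A.Generates s := by
  rw [Generates, ← h.1]
  exact h.lang_subset hs

theorem snoc_mem_lang (h : IsSupcon C A Sc S) {s : List E} {e : E} (hs : s ∈ S.lang) (he : e ∉ Sc)
    (hl : s ++ [e] ∈ A.lang) : s ++ [e] ∈ S.lang := by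
  rw [← h.2.1] at hs ⊢
  exact h.controllable.append_mem hs (by simpa using he) hl

/-- An uncontrollable event that the plant can execute is not blocked by the supremal
controllable behavior. -/
theorem generates_snoc (h : IsSupcon C A Sc S) {s : List E} {e : E} (hs : S.Generates s)
    (he : e ∉ Sc) (hl : A.Generates (s ++ [e])) : S.Generates (s ++ [e]) := by
  by_cases hA : e ∈ S.alphabet
  · rw [Generates, proj_snoc_of_mem hA]
    refine h.snoc_mem_lang hs he ?_
    rw [← proj_snoc_of_mem hA, h.1]
    exact hl
  · rwa [Generates, proj_snoc_of_notMem hA]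

end IsSupcon

/-! ### Observers and nonconflict -/

/-- Let two systems share only events of `D`, and let the projection onto `D` be an observer for
both. A continuation `t` of the composed abstractions to a marked string lifts to a continuation
of the composed system to a marked string: the observer property lifts `t` in each component, and
the two lifts agree on the shared events. -/
theorem exists_marked_extension {S₁ S₂ : Automaton.{u, v} E} {D : Finset E}
    (hD : S₁.alphabet ∩ S₂.alphabet ⊆ D) (h₁ : IsObserver S₁ D) (h₂ : IsObserver S₂ D)
    {s t : List E} (hs₁ : S₁.Generates s) (hs₂ : S₂.Generates s) (htD : ∀ e ∈ t, e ∈ D)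
    (ht : ((S₁.project D).sync (S₂.project D)).Marks (s ++ t)) :
    ∃ w, proj D w = t ∧ S₁.Marks (s ++ w) ∧ S₂.Marks (s ++ w) := by
  have lift : ∀ S : Automaton.{u, v} E, IsObserver S D → S.Generates s →
      (S.project D).Marks (s ++ t) →
      ∃ w, (∀ e ∈ w, e ∈ S.alphabet) ∧ proj D w = proj S.alphabet t ∧
        proj S.alphabet s ++ w ∈ S.markedLang := by
    intro S hS hs hm
    rw [Marks, markedLang_project] at hm
    have heq : proj (S.alphabet ∩ D) (s ++ t) =
        proj D (proj S.alphabet s) ++ proj S.alphabet t := by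
      rw [proj_append, proj_proj, Finset.inter_comm D, ← proj_proj S.alphabet D t,
        proj_eq_self htD]
    obtain ⟨w, hw, hpw⟩ := hS _ hm _ hs ⟨_, heq.symm⟩
    rw [heq, proj_append] at hpw
    exact ⟨w, fun e he => mem_alphabet_of_mem_lang (S.markedLang_subset_lang hw) e (by simp [he]),
      List.append_cancel_left hpw, hw⟩
  obtain ⟨w₁, hw₁, hp₁, hm₁⟩ := lift S₁ h₁ hs₁ (marks_sync.1 ht).1
  obtain ⟨w₂, hw₂, hp₂, hm₂⟩ := lift S₂ h₂ hs₂ (marks_sync.1 ht).2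
  -- Interleaving `w₁` with `t` before `w₂` keeps control of the order of the events of `D`.
  obtain ⟨x, -, hx₁, hxD⟩ := exists_interleaving hw₁ htD hp₁
  have hx₂ : proj S₂.alphabet (proj (S₁.alphabet ∪ D) x) =
      proj (S₁.alphabet ∪ D) w₂ := by
    have e₁ : proj (S₁.alphabet ∪ D) w₂ = proj D w₂ := proj_congr fun e he => by
      have := @hD e
      have := hw₂ e he
      simp only [Finset.mem_inter, Finset.mem_union] at *
      tauto
    have e₂ : S₂.alphabet ∩ (S₁.alphabet ∪ D) = S₂.alphabet ∩ D := by
      ext e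
      have := @hD e
      simp only [Finset.mem_inter, Finset.mem_union] at *
      tauto
    rw [e₁, hp₂, proj_proj, e₂, ← proj_proj, hxD]
  obtain ⟨w, -, hwx, hww⟩ := exists_interleaving (fun e he => (mem_proj.1 he).2) hw₂ hx₂
  have hwD : proj D w = t := by
    rw [← hxD, ← proj_proj_of_subset Finset.subset_union_right (D := D) (D' := S₁.alphabet ∪ D) w,
      hwx, proj_proj_of_subset Finset.subset_union_right]
  have hwS : proj S₁.alphabet w = w₁ := by
    rw [← hx₁, ← proj_proj_of_subset Finset.subset_union_left (D := S₁.alphabet)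
      (D' := S₁.alphabet ∪ D) w, hwx, proj_proj_of_subset Finset.subset_union_left]
  refine ⟨w, hwD, ?_, ?_⟩
  · rwa [Marks, proj_append, hwS]
  · rwa [Marks, proj_append, hww]

/-! ### Groups of agents -/

namespace DCSN

variable {n m : ℕ} (N : DCSN.{u, v} E n m)

theorem alphabet_group (J : Finset (Fin n)) : (N.group J).alphabet = N.events J :=
  alphabet_syncOver J N.agent

variable {N}

theorem generates_group {J : Finset (Fin n)} {s : List E} :
    (N.group J).Generates s ↔ ∀ i ∈ J, (N.agent i).Generates s :=
  generates_syncOver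

theorem marks_group {J : Finset (Fin n)} {s : List E} :
    (N.group J).Marks s ↔ ∀ i ∈ J, (N.agent i).Marks s :=
  marks_syncOver

theorem mem_lang_group {J : Finset (Fin n)} {s : List E} :
    s ∈ (N.group J).lang ↔ (∀ e ∈ s, e ∈ N.events J) ∧ ∀ i ∈ J, (N.agent i).Generates s := by
  rw [mem_lang_iff, alphabet_group, generates_group]

theorem mem_events {J : Finset (Fin n)} {e : E} :
    e ∈ N.events J ↔ ∃ i ∈ J, e ∈ (N.agent i).alphabet :=
  Finset.mem_biUnion

theorem alphabet_subset_events {J : Finset (Fin n)} {i : Fin n} (hi : i ∈ J) :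
    (N.agent i).alphabet ⊆ N.events J :=
  fun _ he => mem_events.2 ⟨i, hi, he⟩

theorem events_mono {J J' : Finset (Fin n)} (h : J ⊆ J') : N.events J ⊆ N.events J' :=
  Finset.biUnion_subset_biUnion_of_subset_left _ h

variable (N) in
theorem events_union (J J' : Finset (Fin n)) : N.events (J ∪ J') = N.events J ∪ N.events J' :=
  Finset.union_biUnion

theorem agent_eq_of_mem {i j : Fin n} {e : E} (hi : e ∈ (N.agent i).alphabet)
    (hj : e ∈ (N.agent j).alphabet) : i = j := by
  by_contra h
  exact Finset.disjoint_left.1 (N.agent_disjoint i j h) hi hj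

variable (N) in
theorem events_inter (J J' : Finset (Fin n)) : N.events (J ∩ J') = N.events J ∩ N.events J' := by
  ext e
  simp only [Finset.mem_inter, mem_events]
  constructor
  · rintro ⟨i, ⟨h, h'⟩, hi⟩
    exact ⟨⟨i, h, hi⟩, i, h', hi⟩
  · rintro ⟨⟨i, h, hi⟩, j, h', hj⟩
    cases agent_eq_of_mem hi hj
    exact ⟨i, ⟨h, h'⟩, hi⟩

/-- Whether an event can follow a string is decided by the only agent that owns the event. -/
theorem snoc_mem_lang_group {J : Finset (Fin n)} {s : List E} {i : Fin n} {e : E}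
    (hs : s ∈ (N.group J).lang) (hi : i ∈ J) (he : e ∈ (N.agent i).alphabet)
    (h : (N.agent i).Generates (s ++ [e])) : s ++ [e] ∈ (N.group J).lang := by
  rw [mem_lang_group] at hs ⊢
  refine ⟨?_, fun j hj => ?_⟩
  · intro x hx
    rcases List.mem_append.1 hx with hx | hx
    · exact hs.1 x hx
    · rw [List.mem_singleton.1 hx]
      exact alphabet_subset_events hi he
  · by_cases hej : e ∈ (N.agent j).alphabet
    · cases agent_eq_of_mem he hej
      exact h
    · rw [Generates, proj_snoc_of_notMem hej]
      exact hs.2 j hj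

variable (N) in
theorem alphabet_sync_group (J J' : Finset (Fin n)) :
    ((N.group J).sync (N.group J')).alphabet = (N.group (J ∪ J')).alphabet := by
  change (N.group J).alphabet ∪ (N.group J').alphabet = _
  rw [alphabet_group, alphabet_group, alphabet_group, events_union]

variable (N) in
theorem lang_sync_group (J J' : Finset (Fin n)) :
    ((N.group J).sync (N.group J')).lang = (N.group (J ∪ J')).lang := by
  ext s
  rw [mem_lang_iff, alphabet_sync_group, generates_sync, mem_lang_iff, generates_group,
    generates_group, generates_group]
  simp only [Finset.mem_union, or_imp, forall_and]

/-- Controllability is inherited by the part of a language that concerns a subgroup of the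
agents, since disjoint alphabets leave every event to a single agent. -/
theorem controllable_proj_events {J J' : Finset (Fin n)} (hJ : J ⊆ J') {K : Set (List E)}
    (hK : Controllable K (N.group J') N.ctrl) :
    Controllable (proj (N.events J) '' K) (N.group J) N.ctrl := by
  constructor
  · rintro _ ⟨s, hs, rfl⟩
    refine mem_lang_group.2 ⟨fun e he => (mem_proj.1 he).2, fun i hi => ?_⟩
    rw [generates_proj (alphabet_subset_events hi)]
    exact (mem_lang_group.1 (hK.1 hs)).2 i (hJ hi)
  · intro s hs e he hl
    rw [prefixClosure_proj] at hs ⊢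
    obtain ⟨s, hs, rfl⟩ := hs
    rw [alphabet_group, Finset.mem_sdiff] at he
    obtain ⟨i, hi, hei⟩ := mem_events.1 he.1
    rw [← proj_snoc_of_mem he.1] at hl ⊢
    have hg := (mem_lang_group.1 hl).2 i hi
    rw [generates_proj (alphabet_subset_events hi)] at hg
    exact ⟨_, hK.append_mem hs (by simpa using he.2)
      (snoc_mem_lang_group (hK.prefixClosure_subset hs) (hJ hi) hei hg), rfl⟩

/-- A behavior of a larger group that is controllable and obeys the constraint of a subgroup stays
within the supremal controllable behavior of the subgroup. -/
theorem marks_of_controllable {J J' : Finset (Fin n)} (hJ : J ⊆ J') {C S : Automaton.{u, v} E}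
    (hC : C.alphabet ⊆ N.events J) (hS : IsSupcon C (N.group J) N.ctrl S) {K : Set (List E)}
    (hK : Controllable K (N.group J') N.ctrl)
    (hM : ∀ s ∈ K, (N.group J).Marks s ∧ C.Marks s) {s : List E} (hs : s ∈ K) : S.Marks s := by
  rw [Marks, hS.1, hS.2.2, alphabet_group]
  refine subset_supC ?_ (controllable_proj_events hJ hK) ⟨s, hs, rfl⟩
  rintro _ ⟨t, ht, rfl⟩
  refine mem_markedLang_iff.2 ⟨fun e he => ?_, marks_sync.2 ⟨?_, ?_⟩⟩
  · exact Finset.mem_union_left _ (by rw [alphabet_group]; exact (mem_proj.1 he).2)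
  · rw [marks_proj (by rw [alphabet_group])]
    exact (hM t ht).1
  · rw [marks_proj hC]
    exact (hM t ht).2

/-! ### Output control consistency -/

/-- An uncontrollable event `e` of `D` that the abstraction of `S` can execute after `s` can be
executed by the agents after finitely many uncontrollable events outside `D`. By the observer
property `S` can execute `e` after some events outside `D`; those that do not belong to the agent
owning `e` may be left out, and the others are uncontrollable by output control consistency. -/
theorem exists_uncontrollable_lift {J J' : Finset (Fin n)} (hJ : J ⊆ J') {S : Automaton.{u, v} E}
    (hSa : S.alphabet = N.events J) (hSl : S.lang ⊆ (N.group J).lang) (hSn : S.Nonblocking)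
    {D : Finset E} (hobs : IsObserver S D) (hocc : ∀ i ∈ J, IsOCC (N.agent i) D N.ctrl)
    {s : List E} {e : E} (hs : s ∈ (N.group J').lang) (hsS : S.Generates s) (heD : e ∈ D)
    (heJ : e ∈ N.events J) (he : e ∉ N.ctrl) (hse : (S.project D).Generates (s ++ [e])) :
    ∃ w : List E, (∀ x ∈ w, x ∉ D) ∧ (∀ x ∈ w, x ∉ N.ctrl) ∧
      s ++ (w ++ [e]) ∈ (N.group J').lang := by
  rw [Generates, lang_project] at hse
  obtain ⟨x, hx, hxe⟩ := hse
  have heS : e ∈ S.alphabet ∩ D := by simp [hSa, heD, heJ]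
  change proj D x = proj (S.alphabet ∩ D) (s ++ [e]) at hxe
  rw [proj_snoc_of_mem heS, Finset.inter_comm, ← proj_proj] at hxe
  obtain ⟨y, hy⟩ := hSn.exists_append hx
  have hpre : proj D (x ++ y) = proj D (proj S.alphabet s) ++ e :: proj D y := by
    rw [proj_append, hxe, List.append_assoc, List.singleton_append]
  obtain ⟨w₀, hw₀, hpw₀⟩ := hobs _ ⟨_, hy, rfl⟩ _ hsS ⟨_, hpre.symm⟩
  rw [hpre, proj_append] at hpw₀
  obtain ⟨v, z, rfl, hvD, -, -⟩ := proj_eq_cons (List.append_cancel_left hpw₀)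
  have hv : proj (N.events J) s ++ v ++ [e] ∈ (N.group J).lang := by
    rw [← hSa]
    exact hSl (mem_lang_of_prefix ⟨z, by simp⟩ (S.markedLang_subset_lang hw₀))
  obtain ⟨i, hi, hei⟩ := mem_events.1 heJ
  have hgi := (mem_lang_group.1 hv).2 i hi
  rw [Generates, proj_snoc_of_mem hei, proj_append,
    proj_proj_of_subset (alphabet_subset_events hi)] at hgi
  obtain ⟨r, v₀, hrv, hr, hv₀⟩ := exists_split_last D (proj (N.agent i).alphabet s)
  have hunc : ∀ x ∈ v₀ ++ proj (N.agent i).alphabet v, x ∉ N.ctrl := by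
    refine hocc i hi r _ e ?_ hr heD he ?_
    · rwa [← List.append_assoc, ← hrv]
    · intro x hx
      rcases List.mem_append.1 hx with hx | hx
      · exact hv₀ x hx
      · exact hvD x (mem_proj.1 hx).1
  refine ⟨proj (N.agent i).alphabet v, fun x hx => hvD x (mem_proj.1 hx).1,
    fun x hx => hunc x (by simp [hx]), ?_⟩
  have hw : ∀ x ∈ proj (N.agent i).alphabet v ++ [e], x ∈ (N.agent i).alphabet := by
    intro x hx
    rcases List.mem_append.1 hx with hx | hx
    · exact (mem_proj.1 hx).2
    · rwa [List.mem_singleton.1 hx]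
  rw [mem_lang_group] at hs ⊢
  refine ⟨fun x hx => ?_, fun j hj => ?_⟩
  · rcases List.mem_append.1 hx with hx | hx
    · exact hs.1 x hx
    · exact alphabet_subset_events (hJ hi) (hw x hx)
  · by_cases hij : i = j
    · subst hij
      rwa [Generates, proj_append, proj_eq_self hw, ← List.append_assoc]
    · rw [Generates, proj_append, proj_eq_nil.2 fun x hx hxj => hij (agent_eq_of_mem (hw x hx) hxj),
        List.append_nil]
      exact hs.2 j hj

/-- Under the observer and output control consistency conditions, the abstraction of a controllable
behavior is controllable with respect to the composed abstractions. -/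
theorem controllable_proj_of_isOCC {J₁ J₂ : Finset (Fin n)} {C₁ C₂ S₁ S₂ : Automaton.{u, v} E}
    (hS₁ : IsSupcon C₁ (N.group J₁) N.ctrl S₁) (hS₂ : IsSupcon C₂ (N.group J₂) N.ctrl S₂)
    {D : Finset E} (hD : D ⊆ N.events (J₁ ∪ J₂)) (h₁ : IsObserver S₁ D) (h₂ : IsObserver S₂ D)
    (hocc : ∀ i ∈ J₁ ∪ J₂, IsOCC (N.agent i) D N.ctrl) {K : Set (List E)}
    (hK : Controllable K (N.group (J₁ ∪ J₂)) N.ctrl)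
    (hKS : ∀ s ∈ K, S₁.Generates s ∧ S₂.Generates s) :
    Controllable (proj D '' K) ((S₁.project D).sync (S₂.project D)) N.ctrl := by
  have ha₁ : S₁.alphabet = N.events J₁ := hS₁.1.trans (N.alphabet_group J₁)
  have ha₂ : S₂.alphabet = N.events J₂ := hS₂.1.trans (N.alphabet_group J₂)
  have haB : ((S₁.project D).sync (S₂.project D)).alphabet = D := by
    change S₁.alphabet ∩ D ∪ S₂.alphabet ∩ D = D
    rw [← Finset.union_inter_distrib_right, ha₁, ha₂, ← events_union, Finset.inter_eq_right]
    exact hD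
  have hgen : ∀ t, ((S₁.project D).sync (S₂.project D)).Generates (proj D t) ↔
      ((S₁.project D).sync (S₂.project D)).Generates t := generates_proj haB.le
  constructor
  · rintro _ ⟨s, hs, rfl⟩
    refine mem_lang_iff.2 ⟨fun e he => by rw [haB]; exact (mem_proj.1 he).2, ?_⟩
    rw [hgen, generates_sync]
    exact ⟨(hKS s hs).1.project D, (hKS s hs).2.project D⟩
  · intro s hs e he hl
    rw [prefixClosure_proj] at hs ⊢
    obtain ⟨s, hs, rfl⟩ := hs
    rw [haB, Finset.mem_sdiff] at he
    have hsl := hK.prefixClosure_subset hs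
    have hsS : S₁.Generates s ∧ S₂.Generates s := by
      obtain ⟨t, ht, hst⟩ := hs
      exact ⟨(hKS t ht).1.of_prefix hst, (hKS t ht).2.of_prefix hst⟩
    have hse := (mem_lang_iff.1 hl).2
    rw [← proj_snoc_of_mem he.1, hgen, generates_sync] at hse
    have hlift : ∃ w : List E, (∀ x ∈ w, x ∉ D) ∧ (∀ x ∈ w, x ∉ N.ctrl) ∧
        s ++ (w ++ [e]) ∈ (N.group (J₁ ∪ J₂)).lang := by
      have heD := hD he.1
      rw [events_union, Finset.mem_union] at heD
      rcases heD with heJ | heJ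
      · exact exists_uncontrollable_lift Finset.subset_union_left ha₁ hS₁.lang_subset hS₁.2.1 h₁
          (fun i hi => hocc i (Finset.mem_union_left _ hi)) hsl hsS.1 he.1 heJ he.2 hse.1
      · exact exists_uncontrollable_lift Finset.subset_union_right ha₂ hS₂.lang_subset hS₂.2.1 h₂
          (fun i hi => hocc i (Finset.mem_union_right _ hi)) hsl hsS.2 he.1 heJ he.2 hse.2
    obtain ⟨w, hwD, hwc, hw⟩ := hlift
    refine ⟨_, hK.append_mem hs (fun x hx => ?_) hw, ?_⟩
    · rcases List.mem_append.1 hx with hx | hx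
      · exact hwc x hx
      · rw [List.mem_singleton.1 hx]
        exact he.2
    · rw [← List.append_assoc, proj_snoc_of_mem he.1, proj_append, proj_eq_nil.2 hwD,
        List.append_nil]

/-! ### Resolving the conflict of two subnets -/

/-- Two supremal behaviors composed with a nonblocking resolution `R` of their abstractions form
the supremal behavior of the composed groups, provided that `R` is controllable and marks the
abstraction of every controllable behavior allowed by both. -/
theorem isSupcon_of_resolution {J₁ J₂ : Finset (Fin n)} {C₁ C₂ S₁ S₂ R X : Automaton.{u, v} E}
    (hC₁ : C₁.alphabet ⊆ N.events J₁) (hC₂ : C₂.alphabet ⊆ N.events J₂)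
    (hS₁ : IsSupcon C₁ (N.group J₁) N.ctrl S₁) (hS₂ : IsSupcon C₂ (N.group J₂) N.ctrl S₂)
    {D : Finset E} (hJD : N.events (J₁ ∩ J₂) ⊆ D) (h₁ : IsObserver S₁ D) (h₂ : IsObserver S₂ D)
    (hRa : R.alphabet = ((S₁.project D).sync (S₂.project D)).alphabet) (hRn : R.Nonblocking)
    (hRm : R.markedLang ⊆ ((S₁.project D).sync (S₂.project D)).markedLang)
    (hRc : Controllable R.markedLang ((S₁.project D).sync (S₂.project D)) N.ctrl)
    (hRmax : ∀ K, Controllable K (N.group (J₁ ∪ J₂)) N.ctrl →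
      (∀ s ∈ K, S₁.Marks s ∧ S₂.Marks s) → ∀ s ∈ K, R.Marks s)
    (hXa : X.alphabet = N.events (J₁ ∪ J₂))
    (hXg : ∀ s, X.Generates s ↔ S₁.Generates s ∧ S₂.Generates s ∧ R.Generates s)
    (hXm : ∀ s, X.Marks s ↔ S₁.Marks s ∧ S₂.Marks s ∧ R.Marks s) :
    IsSupcon (C₁.sync C₂) ((N.group J₁).sync (N.group J₂)) N.ctrl X := by
  have ha₁ : S₁.alphabet = N.events J₁ := hS₁.1.trans (N.alphabet_group J₁)
  have ha₂ : S₂.alphabet = N.events J₂ := hS₂.1.trans (N.alphabet_group J₂)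
  have hRD : R.alphabet ⊆ D := by
    rw [hRa]
    exact Finset.union_subset Finset.inter_subset_right Finset.inter_subset_right
  have hXn : X.Nonblocking := by
    refine subset_antisymm X.prefixClosure_markedLang_subset fun s hs => ?_
    obtain ⟨hsa, hsX⟩ := mem_lang_iff.1 hs
    obtain ⟨hs₁, hs₂, hsR⟩ := (hXg s).1 hsX
    obtain ⟨t, ht⟩ := hRn.exists_append hsR
    have htR : ∀ e ∈ t, e ∈ R.alphabet := fun e he =>
      mem_alphabet_of_mem_lang (R.markedLang_subset_lang ht) e (by simp [he])
    have hB : ((S₁.project D).sync (S₂.project D)).Marks (s ++ t) := by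
      rw [Marks, ← hRa, proj_append, proj_eq_self htR]
      exact hRm ht
    obtain ⟨w, hwD, hw₁, hw₂⟩ := exists_marked_extension
      (by rw [ha₁, ha₂, ← events_inter]; exact hJD) h₁ h₂ hs₁ hs₂ (fun e he => hRD (htR e he)) hB
    have hXw : X.Marks (s ++ w) := by
      refine (hXm _).2 ⟨hw₁, hw₂, ?_⟩
      rw [Marks, proj_append, ← proj_proj_of_subset hRD w, hwD, proj_eq_self htR]
      exact ht
    refine ⟨_, hXw, ?_⟩
    rw [proj_append, proj_eq_self hsa]
    exact List.prefix_append ..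
  have hXl : X.lang ⊆ (N.group (J₁ ∪ J₂)).lang := by
    rw [← lang_sync_group]
    intro s hs
    obtain ⟨hsa, hsX⟩ := mem_lang_iff.1 hs
    obtain ⟨hs₁, hs₂, -⟩ := (hXg s).1 hsX
    refine mem_lang_iff.2 ⟨?_, generates_sync.2 ⟨hS₁.generates hs₁, hS₂.generates hs₂⟩⟩
    rwa [alphabet_sync_group, alphabet_group, ← hXa]
  have hXc : Controllable X.markedLang (N.group (J₁ ∪ J₂)) N.ctrl := by
    refine ⟨X.markedLang_subset_lang.trans hXl, fun s hs e he hl => ?_⟩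
    rw [hXn] at hs ⊢
    rw [alphabet_group, Finset.mem_sdiff] at he
    obtain ⟨hsa, hsX⟩ := mem_lang_iff.1 hs
    obtain ⟨hs₁, hs₂, hsR⟩ := (hXg s).1 hsX
    have hl' : s ++ [e] ∈ ((N.group J₁).sync (N.group J₂)).lang := by rwa [lang_sync_group]
    obtain ⟨hg₁, hg₂⟩ := generates_sync.1 (mem_lang_iff.1 hl').2
    have hse₁ := hS₁.generates_snoc hs₁ he.2 hg₁
    have hse₂ := hS₂.generates_snoc hs₂ he.2 hg₂
    refine mem_lang_iff.2 ⟨?_, (hXg _).2 ⟨hse₁, hse₂, ?_⟩⟩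
    · rw [hXa]
      exact (mem_lang_group.1 hl).1
    · by_cases heR : e ∈ R.alphabet
      · rw [Generates, ← hRn, proj_snoc_of_mem heR]
        refine hRc.append_mem (by rw [hRn]; exact hsR) (by simpa using he.2) ?_
        rw [← proj_snoc_of_mem heR, hRa]
        exact generates_sync.2 ⟨hse₁.project D, hse₂.project D⟩
      · rwa [Generates, proj_snoc_of_notMem heR]
  refine ⟨by rw [hXa, alphabet_sync_group, alphabet_group], hXn, subset_antisymm ?_ ?_⟩
  · refine subset_supC (fun s hs => ?_)
      (hXc.congr (N.alphabet_sync_group J₁ J₂).symm (N.lang_sync_group J₁ J₂).symm)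
    obtain ⟨hsa, hsX⟩ := mem_markedLang_iff.1 hs
    obtain ⟨hs₁, hs₂, -⟩ := (hXm s).1 hsX
    obtain ⟨mA₁, mC₁⟩ := hS₁.marks (by rwa [alphabet_group]) hs₁
    obtain ⟨mA₂, mC₂⟩ := hS₂.marks (by rwa [alphabet_group]) hs₂
    refine mem_markedLang_iff.2 ⟨fun e he => Finset.mem_union_left _ ?_,
      marks_sync.2 ⟨marks_sync.2 ⟨mA₁, mA₂⟩, marks_sync.2 ⟨mC₁, mC₂⟩⟩⟩
    rw [alphabet_sync_group, alphabet_group, ← hXa]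
    exact hsa e he
  · intro s hs
    have hK := (controllable_supC (((N.group J₁).sync (N.group J₂)).sync (C₁.sync C₂)).markedLang
      ((N.group J₁).sync (N.group J₂)) N.ctrl).congr (N.alphabet_sync_group J₁ J₂)
      (N.lang_sync_group J₁ J₂)
    have hM := fun t ht => marks_sync.1 (mem_markedLang_iff.1 (supC_subset
      (((N.group J₁).sync (N.group J₂)).sync (C₁.sync C₂)).markedLang
      ((N.group J₁).sync (N.group J₂)) N.ctrl (a := t) ht)).2
    have hm : ∀ t ∈ supC (((N.group J₁).sync (N.group J₂)).sync (C₁.sync C₂)).markedLang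
        ((N.group J₁).sync (N.group J₂)) N.ctrl, S₁.Marks t ∧ S₂.Marks t := fun t ht =>
      ⟨marks_of_controllable Finset.subset_union_left hC₁ hS₁ hK
        (fun r hr => ⟨(marks_sync.1 (hM r hr).1).1, (marks_sync.1 (hM r hr).2).1⟩) ht,
      marks_of_controllable Finset.subset_union_right hC₂ hS₂ hK
        (fun r hr => ⟨(marks_sync.1 (hM r hr).1).2, (marks_sync.1 (hM r hr).2).2⟩) ht⟩
    refine mem_markedLang_iff.2 ⟨?_, (hXm s).2 ⟨(hm s hs).1, (hm s hs).2, hRmax _ hK hm s hs⟩⟩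
    rw [hXa]
    exact (mem_lang_group.1 (hK.1 hs)).1

/-! ### Coordination modules of a basic subnet -/

theorem IsCMReduce.generates_iff {i : Fin n} {S S' : Automaton.{u, v} E}
    (h : N.IsCMReduce i S S') (s : List E) :
    (N.agent i).Generates s ∧ S'.Generates s ↔ (N.agent i).Generates s ∧ S.Generates s := by
  rw [← generates_sync, ← generates_sync]
  exact Equivalent.generates_iff h s

theorem IsCMReduce.marks_iff {i : Fin n} {S S' : Automaton.{u, v} E}
    (h : N.IsCMReduce i S S') (s : List E) :
    (N.agent i).Marks s ∧ S'.Marks s ↔ (N.agent i).Marks s ∧ S.Marks s := by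
  rw [← marks_sync, ← marks_sync]
  exact Equivalent.marks_iff h s

theorem IsCMReduce.alphabet_subset {i : Fin n} {S S' : Automaton.{u, v} E}
    (h : N.IsCMReduce i S S') : S'.alphabet ⊆ (N.agent i).alphabet ∪ S.alphabet := by
  have h' : (N.agent i).alphabet ∪ S'.alphabet = (N.agent i).alphabet ∪ S.alphabet := h.1
  rw [← h']
  exact Finset.subset_union_right

theorem proj_alphabet_inter (A : Automaton.{u, v} E) (D : Finset E) (s : List E) :
    proj (A.alphabet ∩ D) s = proj D (proj A.alphabet s) := by
  rw [proj_proj, Finset.inter_comm]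

/-- The agents of a group with their local coordination modules generate what the centralized
supervisor generates. An uncontrollable event is never blocked by a controllable behavior; a
controllable event belongs to one agent, whose module decides correctly by observability. -/
theorem generates_localCM_iff {J : Finset (Fin n)} (hJ : J.Nonempty) {C SUP : Automaton.{u, v} E}
    (hS : IsSupcon C (N.group J) N.ctrl SUP) {D : Finset E}
    (hD : N.Coordinable J SUP.markedLang D) (s : List E) :
    (∀ i ∈ J, (N.agent i).Generates s ∧
      (N.localCM i SUP ((N.agent i).alphabet ∪ D)).Generates s) ↔ SUP.Generates s := by
  have ha : SUP.alphabet = N.events J := hS.1.trans (N.alphabet_group J)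
  constructor
  · intro h
    induction s using List.reverseRecOn with
    | nil =>
      -- Only the modules tell whether the supervisor is the empty automaton.
      obtain ⟨i, hi⟩ := hJ
      have h0 : ((SUP.project ((N.agent i).alphabet ∪ D)).init).isSome :=
        nil_mem_lang.1 (h i hi).2
      rw [Option.isSome_map] at h0
      exact nil_mem_lang.2 h0
    | append_singleton s e ih =>
      have hs : SUP.Generates s := ih fun i hi =>
        ⟨(h i hi).1.of_prefix (List.prefix_append ..), (h i hi).2.of_prefix (List.prefix_append ..)⟩
      by_cases hec : e ∈ N.ctrl
      swap
      · exact hS.generates_snoc hs hec (generates_group.2 fun i hi => (h i hi).1)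
      by_cases heJ : e ∈ N.events J
      swap
      · rwa [Generates, proj_snoc_of_notMem (by rwa [ha])]
      obtain ⟨i, hi, hei⟩ := mem_events.1 heJ
      have heS : e ∈ SUP.alphabet ∩ ((N.agent i).alphabet ∪ D) := by simp [ha, heJ, hei]
      have hloc := (h i hi).2
      change proj (SUP.alphabet ∩ ((N.agent i).alphabet ∪ D)) (s ++ [e]) ∈
        ((SUP.project ((N.agent i).alphabet ∪ D)).enableOutside
          ((N.agent i).alphabet ∩ N.ctrl)).lang at hloc
      rw [proj_snoc_of_mem heS] at hloc
      have hpr := snoc_mem_lang_of_enableOutside (Finset.mem_inter.2 ⟨hei, hec⟩)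
        (hs.project ((N.agent i).alphabet ∪ D)) hloc
      rw [lang_project] at hpr
      obtain ⟨x, hx, hxe⟩ := hpr
      obtain ⟨x₁, x₂, rfl, hx₁, hx₂⟩ := proj_eq_append hxe
      obtain ⟨y, z, rfl, hy, -, -⟩ := proj_eq_cons hx₂
      have hye : x₁ ++ y ++ [e] ∈ SUP.lang := mem_lang_of_prefix ⟨z, by simp⟩ hx
      have hpy : proj ((N.agent i).alphabet ∪ D) (x₁ ++ y) =
          proj ((N.agent i).alphabet ∪ D) (proj SUP.alphabet s) := by
        rw [proj_append, hx₁, proj_eq_nil.2 hy, List.append_nil]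
        exact proj_alphabet_inter ..
      have hobs := ((hD.2 i hi).2 _ _ hpy).1 e (by rwa [alphabet_group])
      rw [hS.2.1] at hobs
      rw [Generates, proj_snoc_of_mem (by rwa [ha])]
      refine hobs hye hs ?_
      rw [← proj_snoc_of_mem (by rwa [ha]), hS.1]
      exact generates_group.2 fun i hi => (h i hi).1
  · intro h i hi
    exact ⟨generates_group.1 (hS.generates h) i hi,
      lang_subset_enableOutside _ _ (h.project ((N.agent i).alphabet ∪ D))⟩

/-- The agents of a group with their local coordination modules mark what the centralized
supervisor marks. The module of a single agent suffices for this, by the second condition of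
observability; hence the group has to be nonempty. -/
theorem marks_localCM_iff {J : Finset (Fin n)} (hJ : J.Nonempty) {C SUP : Automaton.{u, v} E}
    (hC : C.alphabet ⊆ N.events J)
    (hS : IsSupcon C (N.group J) N.ctrl SUP) {D : Finset E}
    (hD : N.Coordinable J SUP.markedLang D) (s : List E) :
    (∀ i ∈ J, (N.agent i).Marks s ∧
      (N.localCM i SUP ((N.agent i).alphabet ∪ D)).Marks s) ↔ SUP.Marks s := by
  constructor
  · intro h
    have hs : SUP.Generates s :=
      (generates_localCM_iff hJ hS hD s).1 fun i hi => ⟨(h i hi).1.generates, (h i hi).2.generates⟩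
    obtain ⟨i, hi⟩ := hJ
    have hpr := mem_markedLang_of_enableOutside (hs.project ((N.agent i).alphabet ∪ D)) (h i hi).2
    rw [markedLang_project] at hpr
    obtain ⟨x, hx, hxs⟩ := hpr
    refine ((hD.2 i hi).2 _ _ (hxs.trans (proj_alphabet_inter ..))).2 hx ⟨?_, ?_⟩
    · rw [hS.2.1]
      exact hs
    · rw [hS.1]
      exact marks_group.2 fun i hi => (h i hi).1
  · intro h i hi
    exact ⟨marks_group.1 (hS.marks (by rwa [alphabet_group]) h).1 i hi,
      markedLang_subset_enableOutside _ _ (h.project ((N.agent i).alphabet ∪ D))⟩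

/-- The outcome of the basic subnet synthesis realizes the centralized supervisor. -/
theorem CMBasicSubnet.realizes {k : Fin m} {S : Fin n → Automaton.{u, v} E}
    (h : N.CMBasicSubnet k S) {SUP : Automaton.{u, v} E}
    (hSUP : IsSupcon (N.C k) (N.group (N.J k)) N.ctrl SUP) :
    (∀ s, (∀ i ∈ N.J k, (N.agent i).Generates s ∧ (S i).Generates s) ↔ SUP.Generates s) ∧
    (∀ s, (∀ i ∈ N.J k, (N.agent i).Marks s ∧ (S i).Marks s) ↔ SUP.Marks s) ∧
    ∀ i ∈ N.J k, (S i).alphabet ⊆ N.events (N.J k) := by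
  obtain ⟨SUP', D, hS, hD, hred⟩ := h
  have heq := hS.equivalent hSUP
  refine ⟨fun s => ?_, fun s => ?_, fun i hi => ?_⟩
  · rw [← heq.generates_iff, ← generates_localCM_iff (N.J_nonempty k) hS hD.2.1]
    exact forall₂_congr fun i hi => (hred i hi).generates_iff s
  · rw [← heq.marks_iff, ← marks_localCM_iff (N.J_nonempty k) (N.C_alphabet k) hS hD.2.1]
    exact forall₂_congr fun i hi => (hred i hi).marks_iff s
  · refine (hred i hi).alphabet_subset.trans (Finset.union_subset (alphabet_subset_events hi) ?_)
    change SUP'.alphabet ∩ _ ⊆ _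
    rw [hS.1, alphabet_group]
    exact Finset.inter_subset_left

/-! ### The coordinated system -/

variable {h k : Fin m} {Sh Sk : Fin n → Automaton.{u, v} E}
  {T : Fin n → Option (Automaton.{u, v} E)}

theorem generates_coordinated {s : List E} :
    (N.coordinated h k Sh Sk T).Generates s ↔
      (∀ i ∈ N.J h, (N.agent i).Generates s ∧ (Sh i).Generates s) ∧
      (∀ i ∈ N.J k, (N.agent i).Generates s ∧ (Sk i).Generates s) ∧
      ∀ i ∈ N.J h ∪ N.J k, ∀ S ∈ T i, S.Generates s := by
  have key : ∀ i, ((N.agent i).sync (N.totalCM h k Sh Sk T i)).Generates s ↔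
      (N.agent i).Generates s ∧ (i ∈ N.J h → (Sh i).Generates s) ∧
        (i ∈ N.J k → (Sk i).Generates s) ∧ ∀ S ∈ T i, S.Generates s := by
    intro i
    rw [generates_sync, totalCM, generates_syncList]
    by_cases h₁ : i ∈ N.J h <;> by_cases h₂ : i ∈ N.J k <;> simp [h₁, h₂]
  rw [coordinated, generates_syncOver]
  simp only [key, Finset.mem_union]
  grind

theorem marks_coordinated {s : List E} :
    (N.coordinated h k Sh Sk T).Marks s ↔
      (∀ i ∈ N.J h, (N.agent i).Marks s ∧ (Sh i).Marks s) ∧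
      (∀ i ∈ N.J k, (N.agent i).Marks s ∧ (Sk i).Marks s) ∧
      ∀ i ∈ N.J h ∪ N.J k, ∀ S ∈ T i, S.Marks s := by
  have key : ∀ i, ((N.agent i).sync (N.totalCM h k Sh Sk T i)).Marks s ↔
      (N.agent i).Marks s ∧ (i ∈ N.J h → (Sh i).Marks s) ∧
        (i ∈ N.J k → (Sk i).Marks s) ∧ ∀ S ∈ T i, S.Marks s := by
    intro i
    rw [marks_sync, totalCM, marks_syncList]
    by_cases h₁ : i ∈ N.J h <;> by_cases h₂ : i ∈ N.J k <;> simp [h₁, h₂]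
  rw [coordinated, marks_syncOver]
  simp only [key, Finset.mem_union]
  grind

theorem alphabet_coordinated
    (hSh : ∀ i ∈ N.J h, (Sh i).alphabet ⊆ N.events (N.J h))
    (hSk : ∀ i ∈ N.J k, (Sk i).alphabet ⊆ N.events (N.J k))
    (hT : ∀ i ∈ N.J h ∪ N.J k, ∀ S ∈ T i, S.alphabet ⊆ N.events (N.J h ∪ N.J k)) :
    (N.coordinated h k Sh Sk T).alphabet = N.events (N.J h ∪ N.J k) := by
  rw [coordinated, alphabet_syncOver]
  refine subset_antisymm (Finset.biUnion_subset.2 fun i hi => Finset.union_subset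
    (alphabet_subset_events hi) fun e he => ?_)
    (Finset.biUnion_mono fun i _ => Finset.subset_union_left)
  rw [totalCM, mem_alphabet_syncList] at he
  obtain ⟨A, hA, he⟩ := he
  rw [List.mem_append, List.mem_append, Option.mem_toList] at hA
  rcases hA with (hA | hA) | hA
  · split_ifs at hA with hi'
    · rw [List.mem_singleton.1 hA] at he
      exact events_mono Finset.subset_union_left (hSh i hi' he)
    · simp at hA
  · split_ifs at hA with hi'
    · rw [List.mem_singleton.1 hA] at he
      exact events_mono Finset.subset_union_right (hSk i hi' he)
    · simp at hA
  · exact hT i hi A hA he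

/-- Abstractions of nonblocking automata to the empty event set do not conflict. -/
theorem nonblocking_sync_project_empty {S₁ S₂ : Automaton.{u, v} E} (h₁ : S₁.Nonblocking)
    (h₂ : S₂.Nonblocking) : ((S₁.project ∅).sync (S₂.project ∅)).Nonblocking := by
  refine subset_antisymm (prefixClosure_markedLang_subset _) fun s hs => ?_
  obtain ⟨hsa, hsg⟩ := mem_lang_iff.1 hs
  have hs0 : s = [] := List.eq_nil_iff_forall_not_mem.2 fun e he => by
    have := hsa e he
    change e ∈ S₁.alphabet ∩ ∅ ∪ S₂.alphabet ∩ ∅ at this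
    simp at this
  subst hs0
  have key : ∀ S : Automaton.{u, v} E, S.Nonblocking → (S.project ∅).Generates [] →
      (S.project ∅).Marks [] := by
    intro S hS hg
    rw [Generates, lang_project] at hg
    obtain ⟨x, hx, -⟩ := hg
    obtain ⟨y, hy⟩ := hS.exists_append hx
    rw [Marks, markedLang_project]
    exact ⟨_, hy, proj_eq_nil.2 (by simp)⟩
  obtain ⟨hg₁, hg₂⟩ := generates_sync.1 hsg
  exact subset_prefixClosure _
    (mem_markedLang_iff.2 ⟨by simp, marks_sync.2 ⟨key S₁ h₁ hg₁, key S₂ h₂ hg₂⟩⟩)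

theorem isSupcon_coordinated (hSh : N.CMBasicSubnet h Sh) (hSk : N.CMBasicSubnet k Sk)
    (hT : N.DeconflictBasicSubnet h k T) :
    IsSupcon ((N.C h).sync (N.C k)) ((N.group (N.J h)).sync (N.group (N.J k))) N.ctrl
      (N.coordinated h k Sh Sk T) := by
  obtain ⟨S₁, S₂, D₁, hS₁, hS₂, hJD, hD₁, ho₁, ho₂, hcase⟩ := hT
  obtain ⟨hg₁, hm₁, hal₁⟩ := hSh.realizes hS₁
  obtain ⟨hg₂, hm₂, hal₂⟩ := hSk.realizes hS₂
  rcases hcase with ⟨hnb, hT⟩ | ⟨hnb, D₂, CR, hD₁₂, hD₂, ho₁', ho₂', hocc, hCR, hT⟩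
  · -- Without conflict the composed abstractions are their own resolution.
    refine isSupcon_of_resolution (R := (S₁.project D₁).sync (S₂.project D₁)) (N.C_alphabet h)
      (N.C_alphabet k) hS₁ hS₂ hJD ho₁ ho₂ rfl hnb subset_rfl
      ⟨markedLang_subset_lang _, fun s _ e _ hl => by rwa [hnb]⟩ ?_ ?_ (fun s => ?_) (fun s => ?_)
    · exact fun K _ hK s hs => marks_sync.2 ⟨(hK s hs).1.project D₁, (hK s hs).2.project D₁⟩
    · exact alphabet_coordinated hal₁ hal₂ fun i hi S hS => by simp [hT i hi] at hS
    · rw [generates_coordinated, hg₁, hg₂, generates_sync]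
      refine and_congr_right fun a₁ => and_congr_right fun a₂ => iff_of_true ?_
        ⟨a₁.project D₁, a₂.project D₁⟩
      exact fun i hi S hS => by simp [hT i hi] at hS
    · rw [marks_coordinated, hm₁, hm₂, marks_sync]
      refine and_congr_right fun a₁ => and_congr_right fun a₂ => iff_of_true ?_
        ⟨a₁.project D₁, a₂.project D₁⟩
      exact fun i hi S hS => by simp [hT i hi] at hS
  · have haB : ((S₁.project D₂).sync (S₂.project D₂)).alphabet = D₂ := by
      change S₁.alphabet ∩ D₂ ∪ S₂.alphabet ∩ D₂ = D₂
      rw [← Finset.union_inter_distrib_right, hS₁.1, hS₂.1, alphabet_group, alphabet_group,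
        ← events_union, Finset.inter_eq_right]
      exact hD₂
    have haR : CR.alphabet = D₂ := hCR.1.trans haB
    have hone : (oneState D₂ : Automaton.{u, v} E).alphabet ⊆
        ((S₁.project D₂).sync (S₂.project D₂)).alphabet := haB.ge
    -- For `D₂ = ∅` no agent would receive a module, but then there is no conflict either.
    have hne : D₂.Nonempty := by
      rw [Finset.nonempty_iff_ne_empty]
      rintro rfl
      rw [Finset.subset_empty.1 hD₁₂] at hnb
      exact hnb (nonblocking_sync_project_empty hS₁.2.1 hS₂.2.1)
    obtain ⟨e, he⟩ := hne
    obtain ⟨i₀, hi₀, hei₀⟩ := mem_events.1 (hD₂ he)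
    obtain ⟨T₀, hT₀, hred₀⟩ := (hT i₀ hi₀).1 ⟨e, by simp [haR, he, hei₀]⟩
    have hred : ∀ i ∈ N.J h ∪ N.J k, ∀ S ∈ T i, N.IsCMReduce i CR S := by
      intro i hi S hS
      by_cases hc : (CR.alphabet ∩ (N.agent i).alphabet).Nonempty
      · obtain ⟨S', hS', hr⟩ := (hT i hi).1 hc
        rw [hS', Option.mem_some_iff] at hS
        rwa [← hS]
      · simp [(hT i hi).2 hc] at hS
    refine isSupcon_of_resolution (R := CR) (D := D₂) (N.C_alphabet h) (N.C_alphabet k) hS₁ hS₂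
      (hJD.trans hD₁₂) ho₁' ho₂' hCR.1 hCR.2.1 (fun s hs => ?_) hCR.controllable ?_ ?_
      (fun s => ?_) (fun s => ?_)
    · obtain ⟨hsa, hsm⟩ := mem_markedLang_iff.1 hs
      exact mem_markedLang_iff.2 ⟨by rwa [← hCR.1], (hCR.marks hone hsm).1⟩
    · intro K hK hKS s hs
      rw [Marks, haR, hCR.2.2]
      refine subset_supC ?_ (controllable_proj_of_isOCC hS₁ hS₂ hD₂ ho₁' ho₂' hocc hK
        fun s hs => ⟨(hKS s hs).1.generates, (hKS s hs).2.generates⟩) ⟨s, hs, rfl⟩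
      rintro _ ⟨t, ht, rfl⟩
      refine mem_markedLang_iff.2 ⟨fun x hx => ?_, marks_sync.2 ⟨?_, ?_⟩⟩
      · exact Finset.mem_union_right _ (mem_proj.1 hx).2
      · rw [marks_proj haB.le]
        exact marks_sync.2 ⟨(hKS t ht).1.project D₂, (hKS t ht).2.project D₂⟩
      · exact marks_oneState D₂ _
    · refine alphabet_coordinated hal₁ hal₂ fun i hi S hS =>
        (hred i hi S hS).alphabet_subset.trans (Finset.union_subset (alphabet_subset_events hi) ?_)
      rw [haR]
      exact hD₂
    · rw [generates_coordinated, hg₁, hg₂]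
      refine and_congr_right fun a₁ => and_congr_right fun a₂ => ?_
      have hA : ∀ i ∈ N.J h ∪ N.J k, (N.agent i).Generates s := fun i hi => by
        rcases Finset.mem_union.1 hi with hi | hi
        · exact generates_group.1 (hS₁.generates a₁) i hi
        · exact generates_group.1 (hS₂.generates a₂) i hi
      constructor
      · intro hall
        exact ((hred₀.generates_iff s).1 ⟨hA i₀ hi₀, hall i₀ hi₀ T₀ hT₀⟩).2
      · intro hs i hi S hS
        exact (((hred i hi S hS).generates_iff s).2 ⟨hA i hi, hs⟩).2
    · rw [marks_coordinated, hm₁, hm₂]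
      refine and_congr_right fun a₁ => and_congr_right fun a₂ => ?_
      have hA : ∀ i ∈ N.J h ∪ N.J k, (N.agent i).Marks s := fun i hi => by
        rcases Finset.mem_union.1 hi with hi | hi
        · exact marks_group.1 (hS₁.marks (by rw [alphabet_group]; exact N.C_alphabet h) a₁).1 i hi
        · exact marks_group.1 (hS₂.marks (by rw [alphabet_group]; exact N.C_alphabet k) a₂).1 i hi
      constructor
      · intro hall
        exact ((hred₀.marks_iff s).1 ⟨hA i₀ hi₀, hall i₀ hi₀ T₀ hT₀⟩).2
      · intro hs i hi S hS
        exact (((hred i hi S hS).marks_iff s).2 ⟨hA i hi, hs⟩).2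

end DCSN

end DES

theorem theorem2 {E : Type u} [DecidableEq E] {n m : ℕ} (N : DES.DCSN.{u, v} E n m)
    (h k : Fin m)
    (Sh Sk : Fin n → DES.Automaton.{u, v} E) (T : Fin n → Option (DES.Automaton.{u, v} E))
    (hSh : N.CMBasicSubnet h Sh) (hSk : N.CMBasicSubnet k Sk)
    (hT : N.DeconflictBasicSubnet h k T) :
    DES.IsSupcon ((N.C h).sync (N.C k)) ((N.group (N.J h)).sync (N.group (N.J k))) N.ctrl
        (N.coordinated h k Sh Sk T) ∧
      ∀ SUP : DES.Automaton.{u, v} E,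
        DES.IsSupcon ((N.C h).sync (N.C k)) ((N.group (N.J h)).sync (N.group (N.J k))) N.ctrl SUP →
        (N.coordinated h k Sh Sk T).Equivalent SUP :=
  ⟨DES.DCSN.isSupcon_coordinated hSh hSk hT,
    fun _ hSUP => (DES.DCSN.isSupcon_coordinated hSh hSk hT).equivalent hSUP⟩
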